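/- Let $\mathrm{Sol}$ be the Lie group of matrices $\begin{pmatrix} e^{-z}&0&x\\0&e^{z}&y\\0&0&1\end{pmatrix}$, $x,y,z\in\mathbb R$, with the left-invariant metric $ds^2=e^{2z}dx^2+e^{-2z}dy^2+dz^2$. For this metric the basis of the Lie algebra $$e_1=\begin{pmatrix}0&0&1\\0&0&0\\0&0&0\end{pmatrix},\quad e_2=\begin{pmatrix}0&0&0\\0&0&1\\0&0&0\end{pmatrix},\quad e_3=\begin{pmatrix}-1&0&0\\0&1&0\\0&0&0\end{pmatrix}$$ is orthonormal; it is taken to be positively oriented. Write $\partial=\frac12(\partial_x-i\partial_y)$ and $\bar\partial=\frac12(\partial_x+i\partial_y)$ for a complex parameter $x+iy$. Let $f:M\to\mathrm{Sol}$ be a smooth immersed surface with a smooth chart of $M$ whose coordinate $z=x+iy$ is conformal, so that the induced metric is $e^{2\alpha}dz\,d\bar z$. Let $N$ be the unit normal for which $(f_x,f_y,N)$ is positively oriented, $H$ the mean curvature (half of the trace of the second fundamental form $\langle\nabla\,df,N\rangle$), and $A\,dz^2$, $A=\langle\nabla_{f_z}f_z,N\rangle$, the Hopf differential. A generating spinor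 of $f$ is a smooth $\psi=(\psi_1,\psi_2)$ with values in $\mathbb C^2$ on the domain of the chart such that $f^{-1}\partial f=Z_1e_1+Z_2e_2+Z_3e_3$, where $$Z_1=\tfrac i2(\bar\psi_2^2+\psi_1^2),\quad Z_2=\tfrac12(\bar\psi_2^2-\psi_1^2),\quad Z_3=\psi_1\bar\psi_2 .$$ Let $C=\{Z_3\ne0\}$, and let $B_0$ be the interior of $\{Z_3=0\}$. **Theorem.** (1) Every generating spinor $\psi$ of $f$ satisfies the Dirac equation $$\partial\psi_2+U\psi_1=0,\qquad -\bar\partial\psi_1+V\psi_2=0 \tag{D}$$ in $C$ with $$U=\frac H2(|\psi_1|^2+|\psi_2|^2)-\frac12\bar\psi_2^2\,\frac{\bar\psi_1}{\psi_1},\qquad V=\frac H2(|\psi_1|^2+|\psi_2|^2)+\frac12\bar\psi_1^2\,\frac{\bar\psi_2}{\psi_2},$$ and satisfies the free Dirac equation $\bar\partial\psi_1=\partial\psi_2=0$ in $B_0$. (2) Let $D\subset\mathbb C$ be a simply connected domain, $\psi:D\to\mathbb C^2\setminus\{0\}$ smooth, and $H$ a real-valued function on $D$ such that $\psi$ satisfies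 (D) with the potentials $U,V$ formed from $H$ at the points of $D$ where $Z_3=\psi_1\bar\psi_2\neq0$, and satisfies the free Dirac equation in the interior of $\{Z_3=0\}$ (in particular, $Z_3$ may be nowhere zero on $D$). Then for all $P\in D$ and $g\in\mathrm{Sol}$ there is a smooth immersion $f:D\to\mathrm{Sol}$ with $f(P)=g$ for which the parameter is conformal, $\psi$ is a generating spinor, and the mean curvature equals $H$ wherever $Z_3\ne0$. (3) For a surface as above, on the whole domain of the chart, $$A=(\bar\psi_2\,\partial\psi_1-\psi_1\,\partial\bar\psi_2)+\tfrac12(\bar\psi_2^4-\psi_1^4).$$ (4) In $B_0\cup C$ the Weingarten equations consist of the Dirac equation in (1) and $$\partial\psi_1=\alpha_z\psi_1+Ae^{-\alpha}\psi_2-\tfrac12\bar\psi_2^3,\qquad \bar\partial\psi_2=-\bar Ae^{-\alpha}\psi_1+\alpha_{\bar z}\psi_2-\tfrac12\bar\psi_1^3 .$$ (5) On the whole domain of the chart the Codazzi equations hold: $$\alpha_{z\bar z}-e^{-2\alpha}|A|^2+\tfrac14e^{2\alpha}H^2=\tfrac14\bigl(6|\psi_1|^2|\psi_2|^2-(|\psi_1|^4+|\psi_2|^4)\bigr),$$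 $$A_{\bar z}-\tfrac12H_ze^{2\alpha}=(|\psi_2|^4-|\psi_1|^4)\,\psi_1\bar\psi_2 .$$ -/

import Mathlib

open scoped Manifold ContDiff ComplexConjugate

noncomputable section

/-! # The group Sol and its left-invariant metric -/

/-- The matrix with rows `(e^{-z}, 0, x)`, `(0, e^z, y)`, `(0, 0, 1)`. -/
def solMatrix (x y z : ℝ) : Matrix (Fin 3) (Fin 3) ℝ :=
  !![Real.exp (-z), 0, x; 0, Real.exp z, y; 0, 0, 1]

theorem solMatrix_mul (x y z x' y' z' : ℝ) :
    solMatrix x y z * solMatrix x' y' z' =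
      solMatrix (Real.exp (-z) * x' + x) (Real.exp z * y' + y) (z + z') := by
  ext i j
  fin_cases i <;> fin_cases j <;>
    simp [solMatrix, Matrix.mul_apply, Fin.sum_univ_three, Real.exp_add, mul_comm]

theorem solMatrix_one : solMatrix 0 0 0 = 1 := by
  ext i j
  fin_cases i <;> fin_cases j <;> simp [solMatrix]

/-- The Lie group Sol, as a group of matrices. -/
def Sol : Subgroup (GL (Fin 3) ℝ) where
  carrier := {g | ∃ x y z : ℝ, (g : Matrix (Fin 3) (Fin 3) ℝ) = solMatrix x y z}
  one_mem' := ⟨0, 0, 0, by rw [solMatrix_one]; rfl⟩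
  mul_mem' := by
    rintro a b ⟨x, y, z, h⟩ ⟨x', y', z', h'⟩
    exact ⟨_, _, _, by rw [Units.val_mul, h, h', solMatrix_mul]⟩
  inv_mem' := by
    rintro a ⟨x, y, z, h⟩
    refine ⟨-(Real.exp z * x), -(Real.exp (-z) * y), -z, ?_⟩
    apply Units.inv_eq_of_mul_eq_one_right
    rw [h, solMatrix_mul, ← solMatrix_one]
    congr 1
    · rw [mul_neg, ← mul_assoc, ← Real.exp_add]; simp
    · rw [mul_neg, ← mul_assoc, ← Real.exp_add]; simp
    · simp

/-- The underlying matrix of an element of Sol. -/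
def Sol.toMat (g : Sol) : Matrix (Fin 3) (Fin 3) ℝ := ((g : GL (Fin 3) ℝ) : Matrix _ _ ℝ)

/-- The basis `e₁, e₂, e₃` of the Lie algebra of Sol (indexed by `0, 1, 2`). -/
def solBasis : Fin 3 → Matrix (Fin 3) (Fin 3) ℝ :=
  ![!![0, 0, 1; 0, 0, 0; 0, 0, 0], !![0, 0, 0; 0, 0, 1; 0, 0, 0], !![-1, 0, 0; 0, 1, 0; 0, 0, 0]]

/-- The coefficients of an element of the Lie algebra of Sol with respect to `e₁, e₂, e₃`. The
left-invariant metric is the one for which `e₁, e₂, e₃` is orthonormal, so that inner products are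
dot products of such coefficient vectors; the basis is taken to be positively oriented. -/
def solCoord (X : Matrix (Fin 3) (Fin 3) ℝ) : Fin 3 → ℝ := ![X 0 2, X 1 2, X 1 1]

theorem solCoord_sum (a : Fin 3 → ℝ) : solCoord (∑ k, a k • solBasis k) = a := by
  ext k
  fin_cases k <;> simp [solCoord, solBasis, Fin.sum_univ_three]

/-- `solAlpha i j k = ⟨[eᵢ, eⱼ], eₖ⟩`. -/
def solAlpha (i j k : Fin 3) : ℝ := solCoord ⁅solBasis i, solBasis j⁆ k

/-- The Levi-Civita connection of the left-invariant metric (Koszul formula):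
`solConn k j i` is the coefficient of `eᵢ` in `∇_{eₖ} eⱼ`. -/
def solConn (k j i : Fin 3) : ℝ := (solAlpha k j i + solAlpha i k j + solAlpha i j k) / 2

/-! # Maps from a plane domain to Sol -/

/-- The derivative of `F` at `ζ` in the direction `v`, translated to the unit: `F⁻¹ ∂ᵥF`. -/
def leftDeriv (F : ℂ → Sol) (v ζ : ℂ) : Matrix (Fin 3) (Fin 3) ℝ :=
  Sol.toMat (F ζ)⁻¹ * Matrix.of fun i j => fderiv ℝ (fun w => Sol.toMat (F w) i j) ζ v

/-- The components of `∂ᵥF` in the left-invariant orthonormal frame. -/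
def velocity (F : ℂ → Sol) (v ζ : ℂ) : Fin 3 → ℝ := solCoord (leftDeriv F v ζ)

/-- The covariant derivative `∇ᵥV` along `F` of the vector field along `F` with components `V`
in the left-invariant frame. -/
def covDeriv (F : ℂ → Sol) (V : ℂ → Fin 3 → ℝ) (v ζ : ℂ) : Fin 3 → ℝ := fun i =>
  fderiv ℝ (fun w => V w i) ζ v + ∑ k, ∑ j, velocity F v ζ k * V ζ j * solConn k j i

/-- `⟨∂ᵥF, ∂_wF⟩`, the first fundamental form. -/
def firstForm (F : ℂ → Sol) (v w ζ : ℂ) : ℝ := velocity F v ζ ⬝ᵥ velocity F w ζ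

/-- The components of the unit normal `N` for which `F_x, F_y, N` is positively oriented. -/
def unitNormal (F : ℂ → Sol) (ζ : ℂ) : Fin 3 → ℝ :=
  let c := crossProduct (velocity F 1 ζ) (velocity F Complex.I ζ)
  (Real.sqrt (c ⬝ᵥ c))⁻¹ • c

/-- `⟨∇ᵥ∂_wF, N⟩`, the second fundamental form. -/
def secondForm (F : ℂ → Sol) (v w ζ : ℂ) : ℝ :=
  covDeriv F (velocity F w) v ζ ⬝ᵥ unitNormal F ζ

/-- The parameter `ζ = x + iy` on `Ω` is conformal for `F`. -/
def IsConformalOn (Ω : Set ℂ) (F : ℂ → Sol) : Prop :=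
  ∀ ζ ∈ Ω, firstForm F 1 1 ζ = firstForm F Complex.I Complex.I ζ ∧ firstForm F 1 Complex.I ζ = 0

/-- The function `α` for which `e^{2α} |dζ|²` is the induced metric, in a conformal parameter. -/
def logFactor (F : ℂ → Sol) (ζ : ℂ) : ℝ := Real.log (firstForm F 1 1 ζ) / 2

/-- The mean curvature in a conformal parameter: half of the trace of the second fundamental
form with respect to the first one. -/
def meanCurvature (F : ℂ → Sol) (ζ : ℂ) : ℝ :=
  (secondForm F 1 1 ζ + secondForm F Complex.I Complex.I ζ) / (2 * firstForm F 1 1 ζ)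

/-- The coefficient `A = ⟨∇_{F_ζ} F_ζ, N⟩` of the Hopf differential `A dζ²`, expanded by
bilinearity from `F_ζ = (F_x - i F_y) / 2`. -/
def hopfCoeff (F : ℂ → Sol) (ζ : ℂ) : ℂ :=
  ((secondForm F 1 1 ζ - secondForm F Complex.I Complex.I ζ : ℝ) -
    Complex.I * (secondForm F 1 Complex.I ζ + secondForm F Complex.I 1 ζ : ℝ)) / 4

/-! # Spinors and Dirac equations -/

/-- The operator `∂ = (∂_x - i ∂_y) / 2`. -/
def dz (u : ℂ → ℂ) (ζ : ℂ) : ℂ := (fderiv ℝ u ζ 1 - Complex.I * fderiv ℝ u ζ Complex.I) / 2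

/-- The operator `∂̄ = (∂_x + i ∂_y) / 2`. -/
def dzbar (u : ℂ → ℂ) (ζ : ℂ) : ℂ := (fderiv ℝ u ζ 1 + Complex.I * fderiv ℝ u ζ Complex.I) / 2

/-- `Ψ = F⁻¹ ∂F`, a matrix of the complexified Lie algebra. -/
def leftDz (F : ℂ → Sol) (ζ : ℂ) : Matrix (Fin 3) (Fin 3) ℂ :=
  (1 / 2 : ℂ) • ((leftDeriv F 1 ζ).map Complex.ofReal -
    Complex.I • (leftDeriv F Complex.I ζ).map Complex.ofReal)

/-- The vector `(Z₁, Z₂, Z₃)` determined by a spinor `(a, b)`. -/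
def spinorVec (a b : ℂ) : Fin 3 → ℂ :=
  ![Complex.I / 2 * (conj b ^ 2 + a ^ 2), 1 / 2 * (conj b ^ 2 - a ^ 2), a * conj b]

/-- `ψ = (ψ₁, ψ₂)` is a generating spinor of `F` on `Ω`: `F⁻¹ ∂F = ∑ Zₖ eₖ`. -/
structure IsGeneratingSpinor (Ω : Set ℂ) (F : ℂ → Sol) (ψ₁ ψ₂ : ℂ → ℂ) : Prop where
  smooth₁ : ContDiffOn ℝ ∞ ψ₁ Ω
  smooth₂ : ContDiffOn ℝ ∞ ψ₂ Ω
  eq : ∀ ζ ∈ Ω, leftDz F ζ =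
    ∑ k, spinorVec (ψ₁ ζ) (ψ₂ ζ) k • (solBasis k).map Complex.ofReal

/-- The Dirac equation with the values `U`, `V` of the potentials at the point `ζ`. -/
def DiracAt (U V : ℂ) (ψ₁ ψ₂ : ℂ → ℂ) (ζ : ℂ) : Prop :=
  dz ψ₂ ζ + U * ψ₁ ζ = 0 ∧ -dzbar ψ₁ ζ + V * ψ₂ ζ = 0

/-- The potential `U` for mean curvature `H` and spinor value `(a, b)`, where `a b ≠ 0`. -/
def solU (H : ℝ) (a b : ℂ) : ℂ :=
  H / 2 * (‖a‖ ^ 2 + ‖b‖ ^ 2 : ℝ) - 1 / 2 * conj b ^ 2 * (conj a / a)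

/-- The potential `V` for mean curvature `H` and spinor value `(a, b)`, where `a b ≠ 0`. -/
def solV (H : ℝ) (a b : ℂ) : ℂ :=
  H / 2 * (‖a‖ ^ 2 + ‖b‖ ^ 2 : ℝ) + 1 / 2 * conj a ^ 2 * (conj b / b)

/-- The set where `Z₃ = ψ₁ ψ̄₂ ≠ 0`. -/
def regularSet (Ω : Set ℂ) (ψ₁ ψ₂ : ℂ → ℂ) : Set ℂ := {ζ ∈ Ω | ψ₁ ζ * conj (ψ₂ ζ) ≠ 0}

/-- The interior of the set where `Z₃ = ψ₁ ψ̄₂ = 0`. -/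
def flatSet (Ω : Set ℂ) (ψ₁ ψ₂ : ℂ → ℂ) : Set ℂ := interior {ζ ∈ Ω | ψ₁ ζ * conj (ψ₂ ζ) = 0}

/-- The Dirac equations of Sol: potentials `U`, `V` where `Z₃ ≠ 0`, zero potentials in the
interior of `{Z₃ = 0}`. -/
def SolDirac (Ω : Set ℂ) (H : ℂ → ℝ) (ψ₁ ψ₂ : ℂ → ℂ) : Prop :=
  (∀ ζ ∈ regularSet Ω ψ₁ ψ₂,
    DiracAt (solU (H ζ) (ψ₁ ζ) (ψ₂ ζ)) (solV (H ζ) (ψ₁ ζ) (ψ₂ ζ)) ψ₁ ψ₂ ζ) ∧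
  (∀ ζ ∈ flatSet Ω ψ₁ ψ₂, DiracAt 0 0 ψ₁ ψ₂ ζ)

/-! # Immersed surfaces -/

/-- A smooth immersion of a smooth surface into Sol (smoothness and the differential are those
of the map into the nine-dimensional space of matrices). -/
structure IsSurface {M : Type*} [TopologicalSpace M] [ChartedSpace ℂ M] (f : M → Sol) : Prop where
  smooth : ContMDiff 𝓘(ℝ, ℂ) 𝓘(ℝ, Fin 3 → Fin 3 → ℝ) ∞ (fun p i j => Sol.toMat (f p) i j)
  immersion : ∀ p : M, Function.Injective
    (mfderiv 𝓘(ℝ, ℂ) 𝓘(ℝ, Fin 3 → Fin 3 → ℝ) (fun p i j => Sol.toMat (f p) i j) p)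

/-- `F` is on the plane domain `D` a smooth immersion into Sol for which the parameter is
conformal. -/
structure IsConformalSurfaceOn (D : Set ℂ) (F : ℂ → Sol) : Prop where
  smooth : ContDiffOn ℝ ∞ (fun ζ (i j : Fin 3) => Sol.toMat (F ζ) i j) D
  immersion : ∀ ζ ∈ D, Function.Injective
    (fderiv ℝ (fun ζ (i j : Fin 3) => Sol.toMat (F ζ) i j) ζ)
  conformal : IsConformalOn D F

end

/-! Write Z = f⁻¹∂f and ρ = |ψ₁|² + |ψ₂|². In the left-invariant frame f_x = 2 Re Z and f_y = −2 Im
Z. The spinor formula parametrises isotropic vectors, Z₁² + Z₂² + Z₃² = 0, so the parameter is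
conformal with e^α = ρ, and the unit normal is a real quadratic expression in ψ divided by ρ.

The only derivatives in ∂̄Z are ∂̄ψ₁ and ∂ψ₂. Its imaginary part is prescribed by the Maurer–Cartan
equations, its real part yields the mean curvature. The former fixes ψ₁∂̄ψ₁ + ψ₂∂ψ₂ and makes
ψ̄₂∂̄ψ₁ − ψ̄₁∂ψ₂ real (`spinor_structure_iff`); the latter says that this real number is Hρ²/2. As a
linear system for the two derivatives this has determinant −ρ, and solving it gives a Dirac equation
without denominators, valid on the whole domain (`SpinorSurface.dirac`). Dividing by ψ₁ and ψ₂ gives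
U and V in C, while in B₀ one component vanishes locally and the equations become free.

The other two derivatives, ∂ψ₁ and ∂ψ̄₂, enter through ∂Z. Both A and ∂ρ are linear in them, again
with determinant ±ρ, whence the Weingarten equations. Applying ∂̄∂ = ∂∂̄ to ψ₁ and ψ₂ then gives two
equations that are linear in the two Codazzi expressions, and ρ is once more the determinant
(`SpinorSurface.codazzi`).

Conversely, the Dirac equation implies the Maurer–Cartan equations on C ∪ B₀, which is dense in D.
They do not contain H, so they extend to D by continuity (`structure_of_solDirac`). Sol is solvable,
so they can be integrated one coordinate at a time by the Poincaré lemma: z, then x and y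
(`exists_spinorSurface`). -/

noncomputable section

open scoped Topology

/-! ### Closed one-forms on simply connected open sets. -/

/-- The real line with the discrete topology. -/
def DiscreteReal : Type := ℝ

instance : TopologicalSpace DiscreteReal := ⊥

instance : DiscreteTopology DiscreteReal := ⟨rfl⟩

/-- A function that has locally a primitive on a simply connected open set has a primitive. -/
theorem exists_primitive_of_locally {E : Type*} [NormedAddCommGroup E] [NormedSpace ℝ E]
    {D : Set E} (hD : IsOpen D) (hsc : SimplyConnectedSpace D) (η : E → E →L[ℝ] ℝ)
    (hloc : ∀ c ∈ D, ∃ r > 0, Metric.ball c r ⊆ D ∧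
      ∃ f : E → ℝ, ∀ x ∈ Metric.ball c r, HasFDerivAt f (η x) x) :
    ∃ f : E → ℝ, ∀ x ∈ D, HasFDerivAt f (η x) x := by
  classical
  choose! r hr hrD f hf using hloc
  have hloc_path : LocallyPathConnectedSpace D := hD.locallyPathConnectedSpace
  have hconst : ∀ i j : D, ∀ x ∈ Metric.ball (i : E) (r i) ∩ Metric.ball (j : E) (r j),
      ∀ y ∈ Metric.ball (i : E) (r i) ∩ Metric.ball (j : E) (r j),
      f i x - f j x = f i y - f j y := by
    intro i j x hx y hy
    have hconv : Convex ℝ (Metric.ball (i : E) (r i) ∩ Metric.ball (j : E) (r j)) :=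
      (convex_ball _ _).inter (convex_ball _ _)
    have hd : ∀ w ∈ Metric.ball (i : E) (r i) ∩ Metric.ball (j : E) (r j),
        HasFDerivAt (fun w => f i w - f j w) (0 : E →L[ℝ] ℝ) w := by
      intro w hw
      have := (hf i i.2 w hw.1).fun_sub (hf j j.2 w hw.2)
      rwa [sub_self] at this
    have hop : IsOpen (Metric.ball (i : E) (r i) ∩ Metric.ball (j : E) (r j)) :=
      Metric.isOpen_ball.inter Metric.isOpen_ball
    exact hop.is_const_of_fderiv_eq_zero hconv.isPreconnected
      (fun w hw => (hd w hw).differentiableAt.differentiableWithinAt)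
      (fun w hw => (hd w hw).fderiv) hx hy
  -- The covering space of germs of primitives: over the ball around i, the fibre coordinate v
  -- stands for the primitive f i + v. Changing balls adds a constant, since the intersection of two
  -- balls is convex. Every point x serves as its own preferred ball (`indexAt := id`).
  let Z : FiberBundleCore D D DiscreteReal :=
    { baseSet := fun i => Subtype.val ⁻¹' Metric.ball (i : E) (r i)
      isOpen_baseSet := fun i => Metric.isOpen_ball.preimage continuous_subtype_val
      indexAt := id
      mem_baseSet_at := fun i => Metric.mem_ball_self (hr i i.2)
      coordChange := fun i j x v => (show ℝ from v) + (f i x - f j x)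
      coordChange_self := fun i x _ v => by
        change (show ℝ from v) + (f i x - f i x) = (show ℝ from v)
        ring
      continuousOn_coordChange := by
        intro i j
        rintro ⟨x, v⟩ hx
        have hx' : (x : E) ∈ Metric.ball (i : E) (r i) ∩ Metric.ball (j : E) (r j) := hx.1
        -- With a discrete fibre, continuity means that the transition is locally constant: near (x,
        -- v) the second argument equals v and f i − f j is constant.
        refine ContinuousAt.continuousWithinAt ?_
        have hev : ∀ᶠ p : D × DiscreteReal in 𝓝 (x, v),
            ((show ℝ from p.2) + (f i p.1 - f j p.1) : ℝ) = (show ℝ from v) + (f i x - f j x) := by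
          have h1 : ∀ᶠ p : D × DiscreteReal in 𝓝 (x, v),
              (p.1 : E) ∈ Metric.ball (i : E) (r i) ∩ Metric.ball (j : E) (r j) :=
            ((Metric.isOpen_ball.inter Metric.isOpen_ball).preimage
              (continuous_subtype_val.comp continuous_fst)).mem_nhds hx'
          have h2 : ∀ᶠ p : D × DiscreteReal in 𝓝 (x, v), p.2 = v :=
            (isOpen_discrete ({v} : Set DiscreteReal)).preimage continuous_snd |>.mem_nhds rfl
          filter_upwards [h1, h2] with p hp1 hp2
          rw [hconst i j _ hp1 _ hx', hp2]
        have : ContinuousAt (fun _ : D × DiscreteReal =>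
            (show DiscreteReal from ((show ℝ from v) + (f i x - f j x) : ℝ))) (x, v) :=
          continuousAt_const
        exact this.congr (hev.mono fun p hp => hp.symm)
      coordChange_comp := fun i j k x _ v => by
        change ((show ℝ from v) + (f i x - f j x)) + (f j x - f k x) =
          (show ℝ from v) + (f i x - f k x)
        ring }
  have hcov : IsCoveringMap (Bundle.TotalSpace.proj : Z.TotalSpace → D) :=
    FiberBundle.isCoveringMap (F := DiscreteReal) (E := Z.Fiber)
  obtain ⟨P⟩ : Nonempty D := inferInstance
  -- Simple connectedness enters here: the identity of D lifts to a global section, that is, a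
  -- coherent choice of the additive constants.
  obtain ⟨s, ⟨-, hs⟩, -⟩ := hcov.existsUnique_continuousMap_lifts (ContinuousMap.id D) P
    (⟨P, (show DiscreteReal from (0 : ℝ))⟩ : Z.TotalSpace) rfl
  have hs' : ∀ x, (s x).proj = x := fun x => congrFun hs x
  let val : D → ℝ := fun x => (show ℝ from (s x).2)
  refine ⟨fun x => if h : x ∈ D then f x x + val ⟨x, h⟩ else 0, fun x hx => ?_⟩
  let x' : D := ⟨x, hx⟩
  -- Read in the fixed chart of x, the section is continuous into a discrete space, hence constant
  -- near x. So the glued function is f x plus a constant there.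
  have hcont : ContinuousAt (fun y => (Z.localTriv x' (s y)).2) x' := by
    have h1 : ContinuousAt (Z.localTriv x') (s x') := by
      refine (Z.localTriv x').continuousAt ?_
      rw [(Z.localTriv x').mem_source]
      change (s x').proj ∈ _
      rw [hs' x']
      exact Metric.mem_ball_self (hr x hx)
    exact continuousAt_snd.comp (ContinuousAt.comp (f := s) h1 s.continuous.continuousAt)
  have hval : ∀ y : D, (show ℝ from (Z.localTriv x' (s y)).2) = val y + (f y y - f x y) := by
    intro y
    rw [Z.localTriv_apply]
    change val y + (f (s y).proj (s y).proj - f x (s y).proj) = _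
    rw [hs' y]
  have hev : ∀ᶠ y in 𝓝 x', val y + (f y y - f x y) = val x' := by
    have h0 : (show ℝ from (Z.localTriv x' (s x')).2) = val x' := by
      rw [hval]; simp [x']
    have := hcont.eventually ((isOpen_discrete {(Z.localTriv x' (s x')).2}).mem_nhds rfl)
    filter_upwards [this] with y hy
    rw [← hval, ← h0]
    exact hy
  have hev' : (fun y => if h : y ∈ D then f y y + val ⟨y, h⟩ else 0) =ᶠ[𝓝 x]
      fun y => f x y + val x' := by
    have h1 : Filter.map Subtype.val (𝓝 x') = 𝓝 x := by
      rw [map_nhds_subtype_coe_eq_nhds hx (hD.mem_nhds hx)]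
    rw [Filter.EventuallyEq, ← h1, Filter.eventually_map]
    filter_upwards [hev] with y hy
    simp only [Subtype.coe_prop, dif_pos]
    change f y y + val y = _
    linarith
  exact ((hf x hx x (Metric.mem_ball_self (hr x hx))).add_const _).congr_of_eventuallyEq hev'

/-- **Poincaré lemma** for closed one-forms on a simply connected open set. -/
theorem exists_primitive_of_closed {E : Type*} [NormedAddCommGroup E] [NormedSpace ℝ E]
    {D : Set E} (hD : IsOpen D) (hsc : SimplyConnectedSpace D) (η : E → E →L[ℝ] ℝ)
    (hη : DifferentiableOn ℝ η D)
    (hdη : ∀ a ∈ D, ∀ x y, fderiv ℝ η a x y = fderiv ℝ η a y x) :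
    ∃ f : E → ℝ, ∀ x ∈ D, HasFDerivAt f (η x) x := by
  refine exists_primitive_of_locally hD hsc η fun c hc => ?_
  obtain ⟨r, hr, hrD⟩ := Metric.isOpen_iff.1 hD c hc
  exact ⟨r, hr, hrD, (convex_ball c r).exists_forall_hasFDerivAt_of_fderiv_symmetric
    Metric.isOpen_ball (hη.mono hrD) fun a ha => hdη a (hrD ha)⟩

/-- The Poincaré lemma in the plane, in terms of the coefficients of the form `p dx + q dy`. -/
theorem exists_primitive_plane {D : Set ℂ} (hD : IsOpen D) (hsc : SimplyConnectedSpace D)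
    {p q : ℂ → ℝ} (hp : DifferentiableOn ℝ p D) (hq : DifferentiableOn ℝ q D)
    (h : ∀ ζ ∈ D, fderiv ℝ p ζ Complex.I = fderiv ℝ q ζ 1) :
    ∃ f : ℂ → ℝ, ∀ ζ ∈ D, HasFDerivAt f (p ζ • Complex.reCLM + q ζ • Complex.imCLM) ζ := by
  have hd : ∀ a ∈ D, HasFDerivAt (fun ζ => p ζ • Complex.reCLM + q ζ • Complex.imCLM)
      ((fderiv ℝ p a).smulRight Complex.reCLM + (fderiv ℝ q a).smulRight Complex.imCLM) a := by
    intro a ha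
    have h1 := (hp.differentiableAt (hD.mem_nhds ha)).hasFDerivAt.smul_const Complex.reCLM
    have h2 := (hq.differentiableAt (hD.mem_nhds ha)).hasFDerivAt.smul_const Complex.imCLM
    exact h1.fun_add h2
  refine exists_primitive_of_closed hD hsc _
    (fun a ha => (hd a ha).differentiableAt.differentiableWithinAt) fun a ha x y => ?_
  rw [(hd a ha).fderiv]
  have key : ∀ (L : ℂ →L[ℝ] ℝ) (x : ℂ), L x = x.re * L 1 + x.im * L Complex.I := by
    intro L x
    conv_lhs => rw [← Complex.re_add_im x]
    have : (x.re : ℂ) + x.im * Complex.I = x.re • (1 : ℂ) + x.im • Complex.I := by simp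
    rw [this, map_add, map_smul, map_smul, smul_eq_mul, smul_eq_mul]
  simp only [add_apply, ContinuousLinearMap.smulRight_apply, smul_apply,
    Complex.reCLM_apply, Complex.imCLM_apply, smul_eq_mul]
  rw [key (fderiv ℝ p a) x, key (fderiv ℝ p a) y, key (fderiv ℝ q a) x, key (fderiv ℝ q a) y,
    h a ha]
  ring

/-! # Calculus of the operators `∂` and `∂̄` -/

theorem dz_congr {u v : ℂ → ℂ} {ζ : ℂ} (h : u =ᶠ[nhds ζ] v) : dz u ζ = dz v ζ := by
  simp only [dz, h.fderiv_eq]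

theorem dzbar_congr {u v : ℂ → ℂ} {ζ : ℂ} (h : u =ᶠ[nhds ζ] v) : dzbar u ζ = dzbar v ζ := by
  simp only [dzbar, h.fderiv_eq]

theorem dz_const (c ζ : ℂ) : dz (fun _ => c) ζ = 0 := by simp [dz]

theorem dzbar_const (c ζ : ℂ) : dzbar (fun _ => c) ζ = 0 := by simp [dzbar]

section Rules

variable {u v : ℂ → ℂ} {ζ : ℂ}

theorem dz_add (hu : DifferentiableAt ℝ u ζ) (hv : DifferentiableAt ℝ v ζ) :
    dz (fun w => u w + v w) ζ = dz u ζ + dz v ζ := by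
  simp only [dz, fderiv_fun_add hu hv, add_apply]; ring

theorem dzbar_add (hu : DifferentiableAt ℝ u ζ) (hv : DifferentiableAt ℝ v ζ) :
    dzbar (fun w => u w + v w) ζ = dzbar u ζ + dzbar v ζ := by
  simp only [dzbar, fderiv_fun_add hu hv, add_apply]; ring

theorem dz_sub (hu : DifferentiableAt ℝ u ζ) (hv : DifferentiableAt ℝ v ζ) :
    dz (fun w => u w - v w) ζ = dz u ζ - dz v ζ := by
  simp only [dz, fderiv_fun_sub hu hv, sub_apply]; ring

theorem dzbar_sub (hu : DifferentiableAt ℝ u ζ) (hv : DifferentiableAt ℝ v ζ) :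
    dzbar (fun w => u w - v w) ζ = dzbar u ζ - dzbar v ζ := by
  simp only [dzbar, fderiv_fun_sub hu hv, sub_apply]; ring

theorem dz_mul (hu : DifferentiableAt ℝ u ζ) (hv : DifferentiableAt ℝ v ζ) :
    dz (fun w => u w * v w) ζ = dz u ζ * v ζ + u ζ * dz v ζ := by
  simp only [dz, fderiv_fun_mul hu hv, add_apply, smul_apply, smul_eq_mul]; ring

theorem dzbar_mul (hu : DifferentiableAt ℝ u ζ) (hv : DifferentiableAt ℝ v ζ) :
    dzbar (fun w => u w * v w) ζ = dzbar u ζ * v ζ + u ζ * dzbar v ζ := by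
  simp only [dzbar, fderiv_fun_mul hu hv, add_apply, smul_apply, smul_eq_mul]; ring

theorem dz_const_mul (c : ℂ) (hu : DifferentiableAt ℝ u ζ) :
    dz (fun w => c * u w) ζ = c * dz u ζ := by
  rw [dz_mul (differentiableAt_const c) hu, dz_const]; ring

theorem dzbar_const_mul (c : ℂ) (hu : DifferentiableAt ℝ u ζ) :
    dzbar (fun w => c * u w) ζ = c * dzbar u ζ := by
  rw [dzbar_mul (differentiableAt_const c) hu, dzbar_const]; ring

theorem differentiableAt_conj (hu : DifferentiableAt ℝ u ζ) :
    DifferentiableAt ℝ (fun w => conj (u w)) ζ :=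
  (Complex.conjCLE.differentiableAt (x := u ζ)).comp ζ hu

theorem differentiableAt_ofReal {g : ℂ → ℝ} (hg : DifferentiableAt ℝ g ζ) :
    DifferentiableAt ℝ (fun w => (g w : ℂ)) ζ :=
  (Complex.ofRealCLM.differentiableAt (x := g ζ)).comp ζ hg

theorem differentiableAt_re (hu : DifferentiableAt ℝ u ζ) :
    DifferentiableAt ℝ (fun w => (u w).re) ζ :=
  (Complex.reCLM.differentiableAt (x := u ζ)).comp ζ hu

theorem differentiableAt_im (hu : DifferentiableAt ℝ u ζ) :
    DifferentiableAt ℝ (fun w => (u w).im) ζ :=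
  (Complex.imCLM.differentiableAt (x := u ζ)).comp ζ hu

theorem fderiv_conj_apply (hu : DifferentiableAt ℝ u ζ) (x : ℂ) :
    fderiv ℝ (fun w => conj (u w)) ζ x = conj (fderiv ℝ u ζ x) := by
  have h : HasFDerivAt (fun w => conj (u w))
      ((Complex.conjCLE : ℂ →L[ℝ] ℂ).comp (fderiv ℝ u ζ)) ζ :=
    (Complex.conjCLE : ℂ →L[ℝ] ℂ).hasFDerivAt.comp ζ hu.hasFDerivAt
  rw [h.fderiv]; simp

theorem fderiv_ofReal_apply {g : ℂ → ℝ} (hg : DifferentiableAt ℝ g ζ) (x : ℂ) :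
    fderiv ℝ (fun w => (g w : ℂ)) ζ x = (fderiv ℝ g ζ x : ℝ) := by
  have h : HasFDerivAt (fun w => (g w : ℂ)) (Complex.ofRealCLM.comp (fderiv ℝ g ζ)) ζ :=
    Complex.ofRealCLM.hasFDerivAt.comp ζ hg.hasFDerivAt
  rw [h.fderiv]; simp

theorem fderiv_re_apply (hu : DifferentiableAt ℝ u ζ) (x : ℂ) :
    fderiv ℝ (fun w => (u w).re) ζ x = (fderiv ℝ u ζ x).re := by
  have h : HasFDerivAt (fun w => (u w).re) (Complex.reCLM.comp (fderiv ℝ u ζ)) ζ :=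
    Complex.reCLM.hasFDerivAt.comp ζ hu.hasFDerivAt
  rw [h.fderiv]; simp

theorem fderiv_im_apply (hu : DifferentiableAt ℝ u ζ) (x : ℂ) :
    fderiv ℝ (fun w => (u w).im) ζ x = (fderiv ℝ u ζ x).im := by
  have h : HasFDerivAt (fun w => (u w).im) (Complex.imCLM.comp (fderiv ℝ u ζ)) ζ :=
    Complex.imCLM.hasFDerivAt.comp ζ hu.hasFDerivAt
  rw [h.fderiv]; simp

theorem dz_conj (hu : DifferentiableAt ℝ u ζ) :
    dz (fun w => conj (u w)) ζ = conj (dzbar u ζ) := by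
  simp only [dz, dzbar, fderiv_conj_apply hu, map_div₀, map_add, map_mul, Complex.conj_I,
    Complex.conj_ofNat]
  ring

theorem dzbar_conj (hu : DifferentiableAt ℝ u ζ) :
    dzbar (fun w => conj (u w)) ζ = conj (dz u ζ) := by
  simp only [dz, dzbar, fderiv_conj_apply hu, map_div₀, map_sub, map_mul, Complex.conj_I,
    Complex.conj_ofNat]
  ring

theorem dzbar_ofReal {g : ℂ → ℝ} (hg : DifferentiableAt ℝ g ζ) :
    dzbar (fun w => (g w : ℂ)) ζ = conj (dz (fun w => (g w : ℂ)) ζ) := by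
  rw [← dzbar_conj (differentiableAt_ofReal hg)]
  simp only [Complex.conj_ofReal]

theorem dz_log {g : ℂ → ℝ} (hg : DifferentiableAt ℝ g ζ) (h0 : g ζ ≠ 0) :
    (g ζ : ℂ) * dz (fun w => (Real.log (g w) : ℂ)) ζ = dz (fun w => (g w : ℂ)) ζ := by
  have h1 : HasFDerivAt (fun w => Real.log (g w)) ((g ζ)⁻¹ • fderiv ℝ g ζ) ζ :=
    hg.hasFDerivAt.log h0
  have h0' : (g ζ : ℂ) ≠ 0 := by exact_mod_cast h0
  simp only [dz, fderiv_ofReal_apply hg, fderiv_ofReal_apply h1.differentiableAt, h1.fderiv,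
    smul_apply, smul_eq_mul]
  push_cast
  field_simp

end Rules

section Smooth

variable {Ω : Set ℂ}

theorem contDiffOn_fderiv_apply {E : Type*} [NormedAddCommGroup E] [NormedSpace ℝ E] {u : ℂ → E}
    (hΩ : IsOpen Ω) (hu : ContDiffOn ℝ ∞ u Ω) (v : ℂ) :
    ContDiffOn ℝ ∞ (fun ζ => fderiv ℝ u ζ v) Ω :=
  (hu.fderiv_of_isOpen hΩ (by simp)).clm_apply contDiffOn_const

theorem contDiffOn_dz {u : ℂ → ℂ} (hΩ : IsOpen Ω) (hu : ContDiffOn ℝ ∞ u Ω) :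
    ContDiffOn ℝ ∞ (dz u) Ω :=
  ((contDiffOn_fderiv_apply hΩ hu 1).sub
    (contDiffOn_const.mul (contDiffOn_fderiv_apply hΩ hu Complex.I))).div_const 2

theorem contDiffOn_dzbar {u : ℂ → ℂ} (hΩ : IsOpen Ω) (hu : ContDiffOn ℝ ∞ u Ω) :
    ContDiffOn ℝ ∞ (dzbar u) Ω :=
  ((contDiffOn_fderiv_apply hΩ hu 1).add
    (contDiffOn_const.mul (contDiffOn_fderiv_apply hΩ hu Complex.I))).div_const 2

theorem contDiffOn_conj {u : ℂ → ℂ} (hu : ContDiffOn ℝ ∞ u Ω) :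
    ContDiffOn ℝ ∞ (fun ζ => conj (u ζ)) Ω :=
  Complex.conjCLE.contDiff.comp_contDiffOn hu

theorem contDiffOn_re {u : ℂ → ℂ} (hu : ContDiffOn ℝ ∞ u Ω) :
    ContDiffOn ℝ ∞ (fun ζ => (u ζ).re) Ω :=
  Complex.reCLM.contDiff.comp_contDiffOn hu

theorem contDiffOn_im {u : ℂ → ℂ} (hu : ContDiffOn ℝ ∞ u Ω) :
    ContDiffOn ℝ ∞ (fun ζ => (u ζ).im) Ω :=
  Complex.imCLM.contDiff.comp_contDiffOn hu

theorem contDiffOn_ofReal {g : ℂ → ℝ} (hg : ContDiffOn ℝ ∞ g Ω) :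
    ContDiffOn ℝ ∞ (fun ζ => (g ζ : ℂ)) Ω :=
  Complex.ofRealCLM.contDiff.comp_contDiffOn hg

theorem ContDiffOn.differentiableAt_of_isOpen {E : Type*} [NormedAddCommGroup E] [NormedSpace ℝ E]
    {u : ℂ → E} (hu : ContDiffOn ℝ ∞ u Ω) (hΩ : IsOpen Ω) {ζ : ℂ} (hζ : ζ ∈ Ω) :
    DifferentiableAt ℝ u ζ :=
  (hu.differentiableOn (by simp)).differentiableAt (hΩ.mem_nhds hζ)

/-- Second derivatives are symmetric. -/
theorem fderiv_fderiv_comm {E : Type*} [NormedAddCommGroup E] [NormedSpace ℝ E] {u : ℂ → E}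
    (hΩ : IsOpen Ω) (hu : ContDiffOn ℝ ∞ u Ω) {ζ : ℂ} (hζ : ζ ∈ Ω) (v w : ℂ) :
    fderiv ℝ (fun x => fderiv ℝ u x v) ζ w = fderiv ℝ (fun x => fderiv ℝ u x w) ζ v := by
  have hd : DifferentiableAt ℝ (fderiv ℝ u) ζ :=
    (hu.fderiv_of_isOpen (m := ∞) hΩ (by simp)).differentiableAt_of_isOpen hΩ hζ
  have key : ∀ a b : ℂ, fderiv ℝ (fun x => fderiv ℝ u x a) ζ b = fderiv ℝ (fderiv ℝ u) ζ b a := by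
    intro a b
    rw [fderiv_clm_apply hd (differentiableAt_const a)]
    simp
  rw [key, key]
  have hc : ContDiffAt ℝ ∞ u ζ := hu.contDiffAt (hΩ.mem_nhds hζ)
  have h2 : minSmoothness ℝ 2 ≤ (∞ : WithTop ℕ∞) := by
    rw [minSmoothness_of_isRCLikeNormedField]; exact WithTop.coe_le_coe.2 (le_top : (2 : ℕ∞) ≤ ⊤)
  exact (hc.isSymmSndFDerivAt h2) w v

/-- Symmetry of second derivatives in complex form; applied to ψ₁ and ψ₂, it is the source of the
Codazzi equations. -/
theorem dzbar_dz_comm {u : ℂ → ℂ} (hΩ : IsOpen Ω) (hu : ContDiffOn ℝ ∞ u Ω) {ζ : ℂ} (hζ : ζ ∈ Ω) :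
    dzbar (dz u) ζ = dz (dzbar u) ζ := by
  have h1 : DifferentiableAt ℝ (fun x => fderiv ℝ u x 1) ζ :=
    (contDiffOn_fderiv_apply hΩ hu 1).differentiableAt_of_isOpen hΩ hζ
  have h2 : DifferentiableAt ℝ (fun x => fderiv ℝ u x Complex.I) ζ :=
    (contDiffOn_fderiv_apply hΩ hu Complex.I).differentiableAt_of_isOpen hΩ hζ
  have h3 : DifferentiableAt ℝ (fun x => Complex.I * fderiv ℝ u x Complex.I) ζ := h2.const_mul _
  have e1 : dz u = fun x => (1 / 2 : ℂ) * (fderiv ℝ u x 1 - Complex.I * fderiv ℝ u x Complex.I) := by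
    funext x; simp only [dz]; ring
  have e2 : dzbar u = fun x =>
      (1 / 2 : ℂ) * (fderiv ℝ u x 1 + Complex.I * fderiv ℝ u x Complex.I) := by
    funext x; simp only [dzbar]; ring
  rw [e1, e2, dzbar_const_mul _ (h1.fun_sub h3), dz_const_mul _ (h1.fun_add h3),
    dzbar_sub h1 h3, dz_add h1 h3, dzbar_const_mul _ h2,
    dz_const_mul _ h2]
  simp only [dz, dzbar]
  rw [fderiv_fderiv_comm hΩ hu hζ Complex.I 1]
  ring

end Smooth

/-! # Left-invariant coordinates on Sol -/

/-- The element of Sol with given coordinates. -/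
def solElt (x y z : ℝ) : Sol :=
  ⟨⟨solMatrix x y z, solMatrix (-(Real.exp z * x)) (-(Real.exp (-z) * y)) (-z), by
    rw [solMatrix_mul, ← solMatrix_one]
    congr 1
    · rw [mul_neg, ← mul_assoc, ← Real.exp_add]; simp
    · rw [mul_neg, ← mul_assoc, ← Real.exp_add]; simp
    · simp, by
    rw [solMatrix_mul, ← solMatrix_one]
    congr 1
    · simp
    · simp
    · simp⟩, x, y, z, rfl⟩

theorem toMat_solElt (x y z : ℝ) : Sol.toMat (solElt x y z) = solMatrix x y z := rfl

theorem toMat_solElt_inv (x y z : ℝ) : Sol.toMat (solElt x y z)⁻¹ =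
    solMatrix (-(Real.exp z * x)) (-(Real.exp (-z) * y)) (-z) := rfl

theorem exists_eq_solElt (g : Sol) : ∃ x y z, g = solElt x y z := by
  obtain ⟨g, x, y, z, h⟩ := g
  exact ⟨x, y, z, Subtype.ext (Units.ext h)⟩

/-- The `1 1` entry is e^z. It takes the place of the coordinate z in what follows, so that
derivatives of maps into Sol can be expressed by matrix entries alone. -/
theorem toMat_pos (g : Sol) : 0 < Sol.toMat g 1 1 := by
  obtain ⟨x, y, z, rfl⟩ := exists_eq_solElt g
  simp [toMat_solElt, solMatrix, Real.exp_pos]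

theorem toMat_row_two (g : Sol) (j : Fin 3) : Sol.toMat g 2 j = if j = 2 then 1 else 0 := by
  obtain ⟨x, y, z, rfl⟩ := exists_eq_solElt g
  fin_cases j <;> simp [toMat_solElt, solMatrix]

theorem toMat_zero_one (g : Sol) : Sol.toMat g 0 1 = 0 := by
  obtain ⟨x, y, z, rfl⟩ := exists_eq_solElt g
  simp [toMat_solElt, solMatrix]

theorem toMat_one_zero (g : Sol) : Sol.toMat g 1 0 = 0 := by
  obtain ⟨x, y, z, rfl⟩ := exists_eq_solElt g
  simp [toMat_solElt, solMatrix]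

theorem toMat_zero_zero (g : Sol) : Sol.toMat g 0 0 = (Sol.toMat g 1 1)⁻¹ := by
  obtain ⟨x, y, z, rfl⟩ := exists_eq_solElt g
  simp [toMat_solElt, solMatrix, Real.exp_neg]

theorem toMat_inv (g : Sol) : Sol.toMat g⁻¹ =
    !![Sol.toMat g 1 1, 0, -(Sol.toMat g 1 1 * Sol.toMat g 0 2);
      0, (Sol.toMat g 1 1)⁻¹, -((Sol.toMat g 1 1)⁻¹ * Sol.toMat g 1 2); 0, 0, 1] := by
  obtain ⟨x, y, z, rfl⟩ := exists_eq_solElt g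
  rw [toMat_solElt_inv, toMat_solElt]
  ext i j
  fin_cases i <;> fin_cases j <;> simp [solMatrix, Real.exp_neg]

/-- The left-invariant form of the derivative of a map into Sol. -/
theorem leftDeriv_eq (F : ℂ → Sol) (v ζ : ℂ) : leftDeriv F v ζ =
    !![Sol.toMat (F ζ) 1 1 * fderiv ℝ (fun w => Sol.toMat (F w) 0 0) ζ v, 0,
        Sol.toMat (F ζ) 1 1 * fderiv ℝ (fun w => Sol.toMat (F w) 0 2) ζ v;
      0, (Sol.toMat (F ζ) 1 1)⁻¹ * fderiv ℝ (fun w => Sol.toMat (F w) 1 1) ζ v,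
        (Sol.toMat (F ζ) 1 1)⁻¹ * fderiv ℝ (fun w => Sol.toMat (F w) 1 2) ζ v; 0, 0, 0] := by
  have h2 : ∀ j, fderiv ℝ (fun w => Sol.toMat (F w) 2 j) ζ v = 0 := by
    intro j; simp [toMat_row_two]
  have h01 : fderiv ℝ (fun w => Sol.toMat (F w) 0 1) ζ v = 0 := by simp [toMat_zero_one]
  have h10 : fderiv ℝ (fun w => Sol.toMat (F w) 1 0) ζ v = 0 := by simp [toMat_one_zero]
  ext i j
  fin_cases i <;> fin_cases j <;>
    simp [leftDeriv, Matrix.mul_apply, Fin.sum_univ_three, toMat_inv, h2, h01, h10]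

theorem velocity_eq (F : ℂ → Sol) (v ζ : ℂ) : velocity F v ζ =
    ![Sol.toMat (F ζ) 1 1 * fderiv ℝ (fun w => Sol.toMat (F w) 0 2) ζ v,
      (Sol.toMat (F ζ) 1 1)⁻¹ * fderiv ℝ (fun w => Sol.toMat (F w) 1 2) ζ v,
      (Sol.toMat (F ζ) 1 1)⁻¹ * fderiv ℝ (fun w => Sol.toMat (F w) 1 1) ζ v] := by
  ext k
  fin_cases k <;> simp [velocity, solCoord, leftDeriv_eq]

/-- The only nonzero derivatives of the frame are ∇_{e₁}e₁ = −e₃, ∇_{e₁}e₃ = e₁, ∇_{e₂}e₂ = e₃ and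
∇_{e₂}e₃ = −e₂. -/
theorem solConn_sum (a b : Fin 3 → ℝ) (i : Fin 3) :
    ∑ k, ∑ j, a k * b j * solConn k j i =
      (![a 0 * b 2, -(a 1 * b 2), -(a 0 * b 0) + a 1 * b 1] : Fin 3 → ℝ) i := by
  fin_cases i <;>
    simp [Fin.sum_univ_three, solConn, solAlpha, solCoord, solBasis, Ring.lie_def,
      Matrix.mul_apply]

theorem covDeriv_eq (F : ℂ → Sol) (V : ℂ → Fin 3 → ℝ) (v ζ : ℂ) (i : Fin 3) :
    covDeriv F V v ζ i = fderiv ℝ (fun w => V w i) ζ v +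
      (![velocity F v ζ 0 * V ζ 2, -(velocity F v ζ 1 * V ζ 2),
        -(velocity F v ζ 0 * V ζ 0) + velocity F v ζ 1 * V ζ 1] : Fin 3 → ℝ) i := by
  rw [covDeriv, solConn_sum]

section Structure

variable {Ω : Set ℂ} {F : ℂ → Sol}

/-- The structure equations of a map into Sol. -/
theorem velocity_structure (hΩ : IsOpen Ω)
    (hF : ∀ i j, ContDiffOn ℝ ∞ (fun w => Sol.toMat (F w) i j) Ω) {ζ : ℂ} (hζ : ζ ∈ Ω) (v w : ℂ) :
    fderiv ℝ (fun x => velocity F v x 0) ζ w - fderiv ℝ (fun x => velocity F w x 0) ζ v =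
        velocity F w ζ 2 * velocity F v ζ 0 - velocity F v ζ 2 * velocity F w ζ 0 ∧
      fderiv ℝ (fun x => velocity F v x 1) ζ w - fderiv ℝ (fun x => velocity F w x 1) ζ v =
        -(velocity F w ζ 2 * velocity F v ζ 1 - velocity F v ζ 2 * velocity F w ζ 1) ∧
      fderiv ℝ (fun x => velocity F v x 2) ζ w = fderiv ℝ (fun x => velocity F w x 2) ζ v := by
  have hd : ∀ i j, DifferentiableAt ℝ (fun w => Sol.toMat (F w) i j) ζ := fun i j =>
    (hF i j).differentiableAt_of_isOpen hΩ hζ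
  have hdd : ∀ i j v, DifferentiableAt ℝ (fun x => fderiv ℝ (fun w => Sol.toMat (F w) i j) x v) ζ :=
    fun i j v => (contDiffOn_fderiv_apply hΩ (hF i j) v).differentiableAt_of_isOpen hΩ hζ
  have hne : Sol.toMat (F ζ) 1 1 ≠ 0 := (toMat_pos _).ne'
  have hinv : HasFDerivAt (fun w => (Sol.toMat (F w) 1 1)⁻¹)
      (-((Sol.toMat (F ζ) 1 1) ^ 2)⁻¹ • fderiv ℝ (fun w => Sol.toMat (F w) 1 1) ζ) ζ :=
    (hasDerivAt_inv hne).comp_hasFDerivAt ζ (hd 1 1).hasFDerivAt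
  have e0 : ∀ v w, fderiv ℝ (fun x => velocity F v x 0) ζ w =
      fderiv ℝ (fun w => Sol.toMat (F w) 1 1) ζ w * fderiv ℝ (fun w => Sol.toMat (F w) 0 2) ζ v +
      Sol.toMat (F ζ) 1 1 * fderiv ℝ (fun x => fderiv ℝ (fun w => Sol.toMat (F w) 0 2) x v) ζ w := by
    intro v w
    simp only [velocity_eq, Matrix.cons_val]
    rw [fderiv_fun_mul (hd 1 1) (hdd 0 2 v)]
    simp only [add_apply, smul_apply, smul_eq_mul]; ring
  have e1 : ∀ j v w, fderiv ℝ (fun x => (Sol.toMat (F x) 1 1)⁻¹ *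
        fderiv ℝ (fun w => Sol.toMat (F w) 1 j) x v) ζ w =
      -((Sol.toMat (F ζ) 1 1) ^ 2)⁻¹ * fderiv ℝ (fun w => Sol.toMat (F w) 1 1) ζ w *
        fderiv ℝ (fun w => Sol.toMat (F w) 1 j) ζ v +
      (Sol.toMat (F ζ) 1 1)⁻¹ *
        fderiv ℝ (fun x => fderiv ℝ (fun w => Sol.toMat (F w) 1 j) x v) ζ w := by
    intro j v w
    rw [fderiv_fun_mul hinv.differentiableAt (hdd 1 j v), hinv.fderiv]
    simp only [add_apply, smul_apply, smul_eq_mul]; ring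
  refine ⟨?_, ?_, ?_⟩
  · rw [e0, e0, fderiv_fderiv_comm hΩ (hF 0 2) hζ v w]
    simp only [velocity_eq, Matrix.cons_val]
    field_simp
    ring
  · simp only [velocity_eq, Matrix.cons_val]
    rw [e1, e1, fderiv_fderiv_comm hΩ (hF 1 2) hζ v w]
    field_simp
    ring
  · simp only [velocity_eq, Matrix.cons_val]
    rw [e1, e1, fderiv_fderiv_comm hΩ (hF 1 1) hζ v w]
    ring

end Structure

/-! # The algebra of spinors -/

/-- The length `|a|² + |b|²` of a spinor. -/
def spinorSq (a b : ℂ) : ℝ := ‖a‖ ^ 2 + ‖b‖ ^ 2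

/-- The normal vector determined by a spinor, of length `|a|² + |b|²`. -/
def spinorNormal (a b : ℂ) : Fin 3 → ℝ :=
  ![-2 * (a * b).im, -2 * (a * b).re, ‖b‖ ^ 2 - ‖a‖ ^ 2]

/-- The variation of `spinorVec` for the variation `p` of `a` and `c` of the conjugate of `b`. -/
def spinorVar (a b p c : ℂ) : Fin 3 → ℂ :=
  ![Complex.I * (conj b * c + a * p), conj b * c - a * p, a * c + conj b * p]

theorem spinorSq_pos {a b : ℂ} (h : a ≠ 0 ∨ b ≠ 0) : 0 < spinorSq a b := by
  unfold spinorSq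
  rcases h with h | h
  · have := norm_pos_iff.2 h; positivity
  · have := norm_pos_iff.2 h; positivity

theorem spinorSq_eq (a b : ℂ) : spinorSq a b = a.re ^ 2 + a.im ^ 2 + b.re ^ 2 + b.im ^ 2 := by
  simp only [spinorSq, Complex.sq_norm, Complex.normSq_apply]; ring

theorem ofReal_spinorSq (a b : ℂ) : (spinorSq a b : ℂ) = a * conj a + b * conj b := by
  rw [Complex.mul_conj, Complex.mul_conj, spinorSq, Complex.sq_norm, Complex.sq_norm]
  push_cast; ring

section

variable (a b : ℂ)

theorem spinorVec_re (k : Fin 3) : (spinorVec a b k).re =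
    (![b.re * b.im - a.re * a.im, (b.re ^ 2 - b.im ^ 2 - a.re ^ 2 + a.im ^ 2) / 2,
      a.re * b.re + a.im * b.im] : Fin 3 → ℝ) k := by
  fin_cases k <;> simp [spinorVec, pow_two] <;> ring

theorem spinorVec_im (k : Fin 3) : (spinorVec a b k).im =
    (![(b.re ^ 2 - b.im ^ 2 + a.re ^ 2 - a.im ^ 2) / 2, -(b.re * b.im) - a.re * a.im,
      a.im * b.re - a.re * b.im] : Fin 3 → ℝ) k := by
  fin_cases k <;> simp [spinorVec, pow_two] <;> ring

theorem spinorVar_re (p c : ℂ) (k : Fin 3) : (spinorVar a b p c k).re =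
    (![-(b.re * c.im - b.im * c.re + a.re * p.im + a.im * p.re),
      b.re * c.re + b.im * c.im - a.re * p.re + a.im * p.im,
      a.re * c.re - a.im * c.im + b.re * p.re + b.im * p.im] : Fin 3 → ℝ) k := by
  fin_cases k <;> simp [spinorVar] <;> ring

theorem spinorVar_im (p c : ℂ) (k : Fin 3) : (spinorVar a b p c k).im =
    (![b.re * c.re + b.im * c.im + a.re * p.re - a.im * p.im,
      b.re * c.im - b.im * c.re - a.re * p.im - a.im * p.re,
      a.re * c.im + a.im * c.re + b.re * p.im - b.im * p.re] : Fin 3 → ℝ) k := by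
  fin_cases k <;> simp [spinorVar] <;> ring

theorem spinorNormal_eq (k : Fin 3) : spinorNormal a b k =
    (![-2 * (a.re * b.im + a.im * b.re), -2 * (a.re * b.re - a.im * b.im),
      b.re ^ 2 + b.im ^ 2 - a.re ^ 2 - a.im ^ 2] : Fin 3 → ℝ) k := by
  fin_cases k <;> simp [spinorNormal, Complex.sq_norm, Complex.normSq_apply]
  ring

end

theorem crossProduct_spinor (a b : ℂ) (x y : Fin 3 → ℝ)
    (hx : ∀ k, x k = 2 * (spinorVec a b k).re) (hy : ∀ k, y k = -2 * (spinorVec a b k).im) :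
    crossProduct x y = spinorSq a b • spinorNormal a b := by
  rw [cross_apply]
  ext k
  simp only [hx, hy, spinorVec_re, spinorVec_im, spinorSq_eq, Pi.smul_apply, smul_eq_mul,
    spinorNormal_eq]
  fin_cases k <;> simp <;> ring

theorem spinorNormal_dot (a b : ℂ) :
    spinorNormal a b ⬝ᵥ spinorNormal a b = spinorSq a b ^ 2 := by
  simp only [dotProduct, Fin.sum_univ_three, spinorNormal_eq, spinorSq_eq, Matrix.cons_val]
  ring

/-- The first two structure equations are an identity for `a p + b q`, the third one is the reality
of `b̄ p - ā q`. -/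
theorem spinor_structure_iff (a b p q : ℂ) :
    (4 * (spinorVar a b p (conj q) 0).im =
        -2 * (spinorVec a b 2).im * (2 * (spinorVec a b 0).re) -
          2 * (spinorVec a b 2).re * (-2 * (spinorVec a b 0).im) ∧
      4 * (spinorVar a b p (conj q) 1).im =
        -(-2 * (spinorVec a b 2).im * (2 * (spinorVec a b 1).re) -
          2 * (spinorVec a b 2).re * (-2 * (spinorVec a b 1).im)) ∧
      4 * (spinorVar a b p (conj q) 2).im = 0) ↔
    a * p + b * q = 1 / 2 * conj a * conj b * spinorSq a b ∧ (conj b * p - conj a * q).im = 0 := by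
  simp only [spinorVar_im, spinorVec_re, spinorVec_im, Matrix.cons_val, Complex.ext_iff,
    spinorSq_eq, Complex.conj_re, Complex.conj_im, Complex.add_re, Complex.mul_re, Complex.add_im,
    Complex.mul_im, Complex.sub_im, Complex.ofReal_re, Complex.ofReal_im, Complex.one_re,
    Complex.one_im, Complex.div_ofNat_re, Complex.div_ofNat_im]
  constructor
  · rintro ⟨h1, h2, h3⟩
    exact ⟨⟨by linear_combination h1 / 4, by linear_combination -h2 / 4⟩,
      by linear_combination h3 / 4⟩
  · rintro ⟨⟨h1, h2⟩, h3⟩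
    exact ⟨by linear_combination 4 * h1, by linear_combination -4 * h2,
      by linear_combination 4 * h3⟩

/-- The two combinations of `p` and `q` determine `p` and `q`. -/
theorem spinor_solve {a b p q : ℂ} (h : a ≠ 0 ∨ b ≠ 0) {g : ℝ}
    (h1 : a * p + b * q = 1 / 2 * conj a * conj b * spinorSq a b)
    (h2 : conj b * p - conj a * q = g * spinorSq a b) :
    p = g * b + 1 / 2 * conj a ^ 2 * conj b ∧ q = -g * a + 1 / 2 * conj b ^ 2 * conj a := by
  have hr : (spinorSq a b : ℂ) ≠ 0 := by exact_mod_cast (spinorSq_pos h).ne'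
  have hr' := ofReal_spinorSq a b
  constructor
  · apply mul_left_cancel₀ hr
    linear_combination p * hr' + conj a * h1 + b * h2
  · apply mul_left_cancel₀ hr
    linear_combination q * hr' + conj b * h1 - a * h2

/-- Three real conditions on two complex unknowns leave one real parameter g. For a surface it is
H(|a|² + |b|²)/2, so integrability is the Dirac equation with H unspecified. -/
theorem spinor_solve_iff {a b p q : ℂ} (h : a ≠ 0 ∨ b ≠ 0) :
    (a * p + b * q = 1 / 2 * conj a * conj b * spinorSq a b ∧ (conj b * p - conj a * q).im = 0) ↔
      ∃ g : ℝ, p = g * b + 1 / 2 * conj a ^ 2 * conj b ∧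
        q = -g * a + 1 / 2 * conj b ^ 2 * conj a := by
  have hr : (spinorSq a b : ℂ) ≠ 0 := by exact_mod_cast (spinorSq_pos h).ne'
  have hr' := ofReal_spinorSq a b
  constructor
  · rintro ⟨h1, h2⟩
    refine ⟨(conj b * p - conj a * q).re / spinorSq a b, spinor_solve h h1 ?_⟩
    rw [Complex.ofReal_div, div_mul_cancel₀ _ hr]
    exact Complex.ext (by simp) (by simpa using h2)
  · rintro ⟨g, rfl, rfl⟩
    refine ⟨by rw [hr']; ring, ?_⟩
    have : conj b * (g * b + 1 / 2 * conj a ^ 2 * conj b) -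
        conj a * (-g * a + 1 / 2 * conj b ^ 2 * conj a) = ((g * spinorSq a b : ℝ) : ℂ) := by
      push_cast; rw [hr']; ring
    rw [this, Complex.ofReal_im]

/-- The normal component of a variation of `spinorVec`, together with the connection term. -/
theorem spinor_mean (a b p q : ℂ) :
    (4 * (spinorVar a b p (conj q) 0).re + (2 * (spinorVec a b 0).re * (2 * (spinorVec a b 2).re)
        + -2 * (spinorVec a b 0).im * (-2 * (spinorVec a b 2).im))) * spinorNormal a b 0 +
      (4 * (spinorVar a b p (conj q) 1).re - (2 * (spinorVec a b 1).re * (2 * (spinorVec a b 2).re)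
        + -2 * (spinorVec a b 1).im * (-2 * (spinorVec a b 2).im))) * spinorNormal a b 1 +
      (4 * (spinorVar a b p (conj q) 2).re + (-(2 * (spinorVec a b 0).re) ^ 2
        - (-2 * (spinorVec a b 0).im) ^ 2 + (2 * (spinorVec a b 1).re) ^ 2
        + (-2 * (spinorVec a b 1).im) ^ 2)) * spinorNormal a b 2 =
    4 * spinorSq a b * (conj b * p - conj a * q).re := by
  simp only [spinorVar_re, spinorVec_re, spinorVec_im, spinorNormal_eq, Matrix.cons_val,
    spinorSq_eq, Complex.conj_re, Complex.conj_im, Complex.mul_re, Complex.sub_re]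
  ring

/-- With t = ∂ψ₁ and s = ∂ψ̄₂ this is ⟨∇_{f_z}f_z, N⟩ multiplied by the square of the length factor
of `spinorNormal`'s source spinor, |a|² + |b|² being the length of `spinorNormal`. The quartic term
is the contribution of the connection. -/
theorem spinor_hopf (a b t s : ℂ) :
    (spinorVar a b t s 0 + spinorVec a b 0 * spinorVec a b 2) * spinorNormal a b 0 +
      (spinorVar a b t s 1 - spinorVec a b 1 * spinorVec a b 2) * spinorNormal a b 1 +
      (spinorVar a b t s 2 - spinorVec a b 0 ^ 2 + spinorVec a b 1 ^ 2) * spinorNormal a b 2 =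
    spinorSq a b * (conj b * t - a * s + 1 / 2 * (conj b ^ 4 - a ^ 4)) := by
  have e0 : (spinorNormal a b 0 : ℂ) = Complex.I * (a * b - conj a * conj b) := by
    apply Complex.ext <;> simp [spinorNormal]
    ring
  have e1 : (spinorNormal a b 1 : ℂ) = -(a * b + conj a * conj b) := by
    apply Complex.ext <;> simp [spinorNormal] <;> ring
  have e2 : (spinorNormal a b 2 : ℂ) = b * conj b - a * conj a := by
    rw [Complex.mul_conj, Complex.mul_conj]
    simp [spinorNormal, Complex.sq_norm]
  rw [e0, e1, e2, ofReal_spinorSq]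
  simp only [spinorVar, spinorVec, Matrix.cons_val]
  ring_nf
  simp only [Complex.I_sq]
  ring

/-! # Derivatives of the vector determined by a spinor -/

section

variable {ψ₁ ψ₂ : ℂ → ℂ} {ζ : ℂ}

theorem differentiableAt_spinorVec (h₁ : DifferentiableAt ℝ ψ₁ ζ) (h₂ : DifferentiableAt ℝ ψ₂ ζ)
    (k : Fin 3) : DifferentiableAt ℝ (fun w => spinorVec (ψ₁ w) (ψ₂ w) k) ζ := by
  have h₃ := differentiableAt_conj h₂
  fin_cases k
  · exact ((h₃.pow 2).add (h₁.pow 2)).const_mul _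
  · exact ((h₃.pow 2).sub (h₁.pow 2)).const_mul _
  · exact h₁.mul h₃

theorem dz_spinorVec (h₁ : DifferentiableAt ℝ ψ₁ ζ) (h₂ : DifferentiableAt ℝ ψ₂ ζ) (k : Fin 3) :
    dz (fun w => spinorVec (ψ₁ w) (ψ₂ w) k) ζ =
      spinorVar (ψ₁ ζ) (ψ₂ ζ) (dz ψ₁ ζ) (dz (fun w => conj (ψ₂ w)) ζ) k := by
  have h₃ := differentiableAt_conj h₂
  have h₁₁ := h₁.fun_mul h₁
  have h₃₃ := h₃.fun_mul h₃
  fin_cases k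
  · simp only [spinorVec, spinorVar, Fin.zero_eta, Matrix.cons_val, pow_two]
    rw [dz_const_mul _ (h₃₃.fun_add h₁₁), dz_add h₃₃ h₁₁, dz_mul h₃ h₃, dz_mul h₁ h₁]
    ring
  · simp only [spinorVec, spinorVar, Fin.mk_one, Matrix.cons_val, pow_two]
    rw [dz_const_mul _ (h₃₃.fun_sub h₁₁), dz_sub h₃₃ h₁₁, dz_mul h₃ h₃, dz_mul h₁ h₁]
    ring
  · simp only [spinorVec, spinorVar, Fin.reduceFinMk, Matrix.cons_val]
    rw [dz_mul h₁ h₃]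
    ring

/-- Since ∂̄ψ̄₂ is the conjugate of ∂ψ₂, only the two derivatives of the Dirac equation occur in
∂̄Z. The other two occur in ∂Z and lead to the Hopf differential. -/
theorem dzbar_spinorVec (h₁ : DifferentiableAt ℝ ψ₁ ζ) (h₂ : DifferentiableAt ℝ ψ₂ ζ)
    (k : Fin 3) : dzbar (fun w => spinorVec (ψ₁ w) (ψ₂ w) k) ζ =
      spinorVar (ψ₁ ζ) (ψ₂ ζ) (dzbar ψ₁ ζ) (conj (dz ψ₂ ζ)) k := by
  have h₃ := differentiableAt_conj h₂
  have h₁₁ := h₁.fun_mul h₁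
  have h₃₃ := h₃.fun_mul h₃
  rw [← dzbar_conj h₂]
  fin_cases k
  · simp only [spinorVec, spinorVar, Fin.zero_eta, Matrix.cons_val, pow_two]
    rw [dzbar_const_mul _ (h₃₃.fun_add h₁₁), dzbar_add h₃₃ h₁₁, dzbar_mul h₃ h₃, dzbar_mul h₁ h₁]
    ring
  · simp only [spinorVec, spinorVar, Fin.mk_one, Matrix.cons_val, pow_two]
    rw [dzbar_const_mul _ (h₃₃.fun_sub h₁₁), dzbar_sub h₃₃ h₁₁, dzbar_mul h₃ h₃, dzbar_mul h₁ h₁]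
    ring
  · simp only [spinorVec, spinorVar, Fin.reduceFinMk, Matrix.cons_val]
    rw [dzbar_mul h₁ h₃]
    ring

theorem fderiv_apply_one (u : ℂ → ℂ) (ζ : ℂ) : fderiv ℝ u ζ 1 = dz u ζ + dzbar u ζ := by
  simp only [dz, dzbar]; ring

theorem fderiv_apply_I (u : ℂ → ℂ) (ζ : ℂ) :
    fderiv ℝ u ζ Complex.I = Complex.I * (dz u ζ - dzbar u ζ) := by
  simp only [dz, dzbar]; linear_combination fderiv ℝ u ζ Complex.I * Complex.I_sq

end

theorem solBasis_sum_apply (c : Fin 3 → ℂ) :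
    ∑ k, c k • (solBasis k).map Complex.ofReal =
      !![-c 2, 0, c 0; 0, c 2, c 1; 0, 0, 0] := by
  ext i j
  fin_cases i <;> fin_cases j <;> simp [solBasis, Fin.sum_univ_three]

/-! # Surfaces with a generating spinor -/

/-- A smooth map into Sol on an open set with a generating spinor without zeros. -/
structure SpinorSurface (Ω : Set ℂ) (F : ℂ → Sol) (ψ₁ ψ₂ : ℂ → ℂ) : Prop where
  isOpen : IsOpen Ω
  smooth : ∀ i j, ContDiffOn ℝ ∞ (fun w => Sol.toMat (F w) i j) Ω
  generating : IsGeneratingSpinor Ω F ψ₁ ψ₂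
  ne_zero : ∀ ζ ∈ Ω, ψ₁ ζ ≠ 0 ∨ ψ₂ ζ ≠ 0

theorem IsGeneratingSpinor.velocity {Ω : Set ℂ} {F : ℂ → Sol} {ψ₁ ψ₂ : ℂ → ℂ}
    (h : IsGeneratingSpinor Ω F ψ₁ ψ₂) {ζ : ℂ} (hζ : ζ ∈ Ω) (k : Fin 3) :
    velocity F 1 ζ k = 2 * (spinorVec (ψ₁ ζ) (ψ₂ ζ) k).re ∧
      velocity F Complex.I ζ k = -2 * (spinorVec (ψ₁ ζ) (ψ₂ ζ) k).im := by
  have key : ∀ i j : Fin 3, (leftDz F ζ i j).re = leftDeriv F 1 ζ i j / 2 ∧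
      (leftDz F ζ i j).im = -leftDeriv F Complex.I ζ i j / 2 := by
    intro i j
    constructor <;> simp [leftDz] <;> ring
  have h0 := h.eq ζ hζ
  rw [solBasis_sum_apply] at h0
  rw [h0] at key
  fin_cases k
  · have := key 0 2
    simp [_root_.velocity, solCoord] at this ⊢
    constructor <;> linarith [this.1, this.2]
  · have := key 1 2
    simp [_root_.velocity, solCoord] at this ⊢
    constructor <;> linarith [this.1, this.2]
  · have := key 1 1
    simp [_root_.velocity, solCoord] at this ⊢
    constructor <;> linarith [this.1, this.2]

namespace SpinorSurface

variable {Ω : Set ℂ} {F : ℂ → Sol} {ψ₁ ψ₂ : ℂ → ℂ} (h : SpinorSurface Ω F ψ₁ ψ₂) {ζ : ℂ}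
include h

theorem differentiableAt₁ (hζ : ζ ∈ Ω) : DifferentiableAt ℝ ψ₁ ζ :=
  h.generating.smooth₁.differentiableAt_of_isOpen h.isOpen hζ

theorem differentiableAt₂ (hζ : ζ ∈ Ω) : DifferentiableAt ℝ ψ₂ ζ :=
  h.generating.smooth₂.differentiableAt_of_isOpen h.isOpen hζ

theorem firstForm_one_one (hζ : ζ ∈ Ω) :
    firstForm F 1 1 ζ = spinorSq (ψ₁ ζ) (ψ₂ ζ) ^ 2 := by
  simp only [firstForm, dotProduct, Fin.sum_univ_three, (h.generating.velocity hζ _).1,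
    spinorVec_re, spinorSq_eq, Matrix.cons_val]
  ring

theorem unitNormal_eq (hζ : ζ ∈ Ω) : unitNormal F ζ =
    (spinorSq (ψ₁ ζ) (ψ₂ ζ))⁻¹ • spinorNormal (ψ₁ ζ) (ψ₂ ζ) := by
  have hr := spinorSq_pos (h.ne_zero ζ hζ)
  simp only [unitNormal, crossProduct_spinor (ψ₁ ζ) (ψ₂ ζ) _ _
    (fun k => (h.generating.velocity hζ k).1) (fun k => (h.generating.velocity hζ k).2)]
  rw [smul_dotProduct, dotProduct_smul, spinorNormal_dot, smul_smul, smul_eq_mul, smul_eq_mul]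
  have : spinorSq (ψ₁ ζ) (ψ₂ ζ) * (spinorSq (ψ₁ ζ) (ψ₂ ζ) * spinorSq (ψ₁ ζ) (ψ₂ ζ) ^ 2) =
      (spinorSq (ψ₁ ζ) (ψ₂ ζ) ^ 2) ^ 2 := by ring
  rw [this, Real.sqrt_sq (by positivity)]
  congr 1
  field_simp

theorem fderiv_velocity_one (hζ : ζ ∈ Ω) (v : ℂ) (k : Fin 3) :
    fderiv ℝ (fun w => velocity F 1 w k) ζ v =
      2 * (fderiv ℝ (fun w => spinorVec (ψ₁ w) (ψ₂ w) k) ζ v).re := by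
  have he : (fun w => velocity F 1 w k) =ᶠ[nhds ζ]
      fun w => 2 * (spinorVec (ψ₁ w) (ψ₂ w) k).re := by
    filter_upwards [h.isOpen.mem_nhds hζ] with w hw using (h.generating.velocity hw k).1
  have hd := differentiableAt_spinorVec (h.differentiableAt₁ hζ) (h.differentiableAt₂ hζ) k
  rw [he.fderiv_eq, fderiv_const_mul (differentiableAt_re hd), smul_apply, fderiv_re_apply hd,
    smul_eq_mul]

theorem fderiv_velocity_I (hζ : ζ ∈ Ω) (v : ℂ) (k : Fin 3) :
    fderiv ℝ (fun w => velocity F Complex.I w k) ζ v =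
      -2 * (fderiv ℝ (fun w => spinorVec (ψ₁ w) (ψ₂ w) k) ζ v).im := by
  have he : (fun w => velocity F Complex.I w k) =ᶠ[nhds ζ]
      fun w => -2 * (spinorVec (ψ₁ w) (ψ₂ w) k).im := by
    filter_upwards [h.isOpen.mem_nhds hζ] with w hw using (h.generating.velocity hw k).2
  have hd := differentiableAt_spinorVec (h.differentiableAt₁ hζ) (h.differentiableAt₂ hζ) k
  rw [he.fderiv_eq, fderiv_const_mul (differentiableAt_im hd), smul_apply, fderiv_im_apply hd,
    smul_eq_mul]

theorem structure_eq (hζ : ζ ∈ Ω) :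
    ψ₁ ζ * dzbar ψ₁ ζ + ψ₂ ζ * dz ψ₂ ζ =
        1 / 2 * conj (ψ₁ ζ) * conj (ψ₂ ζ) * spinorSq (ψ₁ ζ) (ψ₂ ζ) ∧
      (conj (ψ₂ ζ) * dzbar ψ₁ ζ - conj (ψ₁ ζ) * dz ψ₂ ζ).im = 0 := by
  rw [← spinor_structure_iff]
  obtain ⟨h0, h1, h2⟩ := velocity_structure h.isOpen h.smooth hζ 1 Complex.I
  -- From f_x = 2 Re Z and f_y = −2 Im Z, the antisymmetric derivative ∂_y f_x − ∂_x f_y is 4 Im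
  -- ∂̄Z, componentwise.
  have hb : ∀ k, fderiv ℝ (fun w => velocity F 1 w k) ζ Complex.I -
      fderiv ℝ (fun w => velocity F Complex.I w k) ζ 1 =
      4 * (spinorVar (ψ₁ ζ) (ψ₂ ζ) (dzbar ψ₁ ζ) (conj (dz ψ₂ ζ)) k).im := by
    intro k
    rw [← dzbar_spinorVec (h.differentiableAt₁ hζ) (h.differentiableAt₂ hζ),
      h.fderiv_velocity_one hζ, h.fderiv_velocity_I hζ, fderiv_apply_one, fderiv_apply_I]
    simp
    ring
  rw [hb] at h0 h1
  rw [← sub_eq_zero, hb] at h2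
  simp only [(h.generating.velocity hζ _).1, (h.generating.velocity hζ _).2] at h0 h1
  exact ⟨h0, h1, h2⟩

theorem spinorSq_mul_secondForm (hζ : ζ ∈ Ω) (v w : ℂ) :
    spinorSq (ψ₁ ζ) (ψ₂ ζ) * secondForm F v w ζ =
      (fderiv ℝ (fun x => velocity F w x 0) ζ v + velocity F v ζ 0 * velocity F w ζ 2) *
          spinorNormal (ψ₁ ζ) (ψ₂ ζ) 0 +
        (fderiv ℝ (fun x => velocity F w x 1) ζ v - velocity F v ζ 1 * velocity F w ζ 2) *
          spinorNormal (ψ₁ ζ) (ψ₂ ζ) 1 +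
        (fderiv ℝ (fun x => velocity F w x 2) ζ v - velocity F v ζ 0 * velocity F w ζ 0 +
          velocity F v ζ 1 * velocity F w ζ 1) * spinorNormal (ψ₁ ζ) (ψ₂ ζ) 2 := by
  have hr := spinorSq_pos (h.ne_zero ζ hζ)
  rw [secondForm, h.unitNormal_eq hζ, dotProduct_smul, smul_eq_mul, mul_inv_cancel_left₀ hr.ne']
  simp only [dotProduct, Fin.sum_univ_three, covDeriv_eq, Matrix.cons_val]
  ring

theorem secondForm_one_one_add (hζ : ζ ∈ Ω) :
    secondForm F 1 1 ζ + secondForm F Complex.I Complex.I ζ =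
      4 * (conj (ψ₂ ζ) * dzbar ψ₁ ζ - conj (ψ₁ ζ) * dz ψ₂ ζ).re := by
  have hr := spinorSq_pos (h.ne_zero ζ hζ)
  -- The companion of the structure equation: ∂_x f_x + ∂_y f_y is 4 Re ∂̄Z, componentwise.
  have hb : ∀ k, fderiv ℝ (fun w => velocity F 1 w k) ζ 1 +
      fderiv ℝ (fun w => velocity F Complex.I w k) ζ Complex.I =
      4 * (spinorVar (ψ₁ ζ) (ψ₂ ζ) (dzbar ψ₁ ζ) (conj (dz ψ₂ ζ)) k).re := by
    intro k
    rw [← dzbar_spinorVec (h.differentiableAt₁ hζ) (h.differentiableAt₂ hζ),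
      h.fderiv_velocity_one hζ, h.fderiv_velocity_I hζ, fderiv_apply_one, fderiv_apply_I]
    simp
    ring
  have key := spinor_mean (ψ₁ ζ) (ψ₂ ζ) (dzbar ψ₁ ζ) (dz ψ₂ ζ)
  rw [← hb, ← hb, ← hb] at key
  apply mul_left_cancel₀ hr.ne'
  rw [mul_add, h.spinorSq_mul_secondForm hζ, h.spinorSq_mul_secondForm hζ]
  simp only [(h.generating.velocity hζ _).1, (h.generating.velocity hζ _).2]
  linear_combination key

theorem hopfCoeff_eq (hζ : ζ ∈ Ω) : hopfCoeff F ζ =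
    (conj (ψ₂ ζ) * dz ψ₁ ζ - ψ₁ ζ * dz (fun w => conj (ψ₂ w)) ζ)
      + 1 / 2 * (conj (ψ₂ ζ) ^ 4 - ψ₁ ζ ^ 4) := by
  have hr := spinorSq_pos (h.ne_zero ζ hζ)
  have hr' : (spinorSq (ψ₁ ζ) (ψ₂ ζ) : ℂ) ≠ 0 := by exact_mod_cast hr.ne'
  have hb : ∀ k, spinorVar (ψ₁ ζ) (ψ₂ ζ) (dz ψ₁ ζ) (dz (fun w => conj (ψ₂ w)) ζ) k =
      ((fderiv ℝ (fun w => velocity F 1 w k) ζ 1 -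
        fderiv ℝ (fun w => velocity F Complex.I w k) ζ Complex.I : ℝ) -
        Complex.I * (fderiv ℝ (fun w => velocity F Complex.I w k) ζ 1 +
          fderiv ℝ (fun w => velocity F 1 w k) ζ Complex.I : ℝ)) / 4 := by
    intro k
    rw [← dz_spinorVec (h.differentiableAt₁ hζ) (h.differentiableAt₂ hζ)]
    simp only [h.fderiv_velocity_one hζ, h.fderiv_velocity_I hζ, fderiv_apply_one, fderiv_apply_I]
    apply Complex.ext <;> simp <;> ring
  have hv : ∀ k, spinorVec (ψ₁ ζ) (ψ₂ ζ) k =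
      ((velocity F 1 ζ k : ℝ) - Complex.I * (velocity F Complex.I ζ k : ℝ)) / 2 := by
    intro k
    rw [(h.generating.velocity hζ _).1, (h.generating.velocity hζ _).2]
    apply Complex.ext <;> simp
  have key := spinor_hopf (ψ₁ ζ) (ψ₂ ζ) (dz ψ₁ ζ) (dz (fun w => conj (ψ₂ w)) ζ)
  rw [hb, hb, hb, hv, hv, hv] at key
  apply mul_left_cancel₀ hr'
  rw [← key]
  have e : (spinorSq (ψ₁ ζ) (ψ₂ ζ) : ℂ) * hopfCoeff F ζ =
      (((spinorSq (ψ₁ ζ) (ψ₂ ζ) * secondForm F 1 1 ζ : ℝ) -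
        (spinorSq (ψ₁ ζ) (ψ₂ ζ) * secondForm F Complex.I Complex.I ζ : ℝ)) -
      Complex.I * ((spinorSq (ψ₁ ζ) (ψ₂ ζ) * secondForm F 1 Complex.I ζ : ℝ) +
        (spinorSq (ψ₁ ζ) (ψ₂ ζ) * secondForm F Complex.I 1 ζ : ℝ))) / 4 := by
    simp only [hopfCoeff]; push_cast; ring
  rw [e]
  simp only [h.spinorSq_mul_secondForm hζ]
  push_cast
  ring_nf
  simp only [Complex.I_sq]
  ring

/-- The mean curvature in terms of the derivatives of the spinor. -/
theorem meanCurvature_eq (hζ : ζ ∈ Ω) : meanCurvature F ζ * spinorSq (ψ₁ ζ) (ψ₂ ζ) ^ 2 =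
    2 * (conj (ψ₂ ζ) * dzbar ψ₁ ζ - conj (ψ₁ ζ) * dz ψ₂ ζ).re := by
  have hr := spinorSq_pos (h.ne_zero ζ hζ)
  rw [meanCurvature, h.secondForm_one_one_add hζ, h.firstForm_one_one hζ]
  field_simp
  ring

/-- The Dirac equation without denominators, on the whole domain. -/
theorem dirac (hζ : ζ ∈ Ω) :
    dzbar ψ₁ ζ = (meanCurvature F ζ / 2 * spinorSq (ψ₁ ζ) (ψ₂ ζ) : ℝ) * ψ₂ ζ
        + 1 / 2 * conj (ψ₁ ζ) ^ 2 * conj (ψ₂ ζ) ∧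
      dz ψ₂ ζ = -(meanCurvature F ζ / 2 * spinorSq (ψ₁ ζ) (ψ₂ ζ) : ℝ) * ψ₁ ζ
        + 1 / 2 * conj (ψ₂ ζ) ^ 2 * conj (ψ₁ ζ) := by
  obtain ⟨h1, h2⟩ := h.structure_eq hζ
  -- The remaining combination has real part Hρ²/2 by the mean curvature formula, and imaginary part
  -- zero by integrability.
  refine spinor_solve (h.ne_zero ζ hζ) h1 ?_
  have := h.meanCurvature_eq hζ
  rw [← Complex.ofReal_mul]
  refine Complex.ext ?_ ?_
  · rw [Complex.ofReal_re]; linear_combination -this / 2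
  · rw [h2, Complex.ofReal_im]

end SpinorSurface

/-- Where the potentials are defined, the Dirac equation has no denominators. -/
theorem diracAt_iff {H : ℝ} {ψ₁ ψ₂ : ℂ → ℂ} {ζ : ℂ} (h₁ : ψ₁ ζ ≠ 0) (h₂ : ψ₂ ζ ≠ 0) :
    DiracAt (solU H (ψ₁ ζ) (ψ₂ ζ)) (solV H (ψ₁ ζ) (ψ₂ ζ)) ψ₁ ψ₂ ζ ↔
      dzbar ψ₁ ζ = (H / 2 * spinorSq (ψ₁ ζ) (ψ₂ ζ) : ℝ) * ψ₂ ζ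
          + 1 / 2 * conj (ψ₁ ζ) ^ 2 * conj (ψ₂ ζ) ∧
        dz ψ₂ ζ = -(H / 2 * spinorSq (ψ₁ ζ) (ψ₂ ζ) : ℝ) * ψ₁ ζ
          + 1 / 2 * conj (ψ₂ ζ) ^ 2 * conj (ψ₁ ζ) := by
  have e1 : solU H (ψ₁ ζ) (ψ₂ ζ) * ψ₁ ζ = (H / 2 * spinorSq (ψ₁ ζ) (ψ₂ ζ) : ℝ) * ψ₁ ζ
          - 1 / 2 * conj (ψ₂ ζ) ^ 2 * conj (ψ₁ ζ) := by
    simp only [solU, spinorSq]; push_cast; field_simp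
  have e2 : solV H (ψ₁ ζ) (ψ₂ ζ) * ψ₂ ζ = (H / 2 * spinorSq (ψ₁ ζ) (ψ₂ ζ) : ℝ) * ψ₂ ζ
          + 1 / 2 * conj (ψ₁ ζ) ^ 2 * conj (ψ₂ ζ) := by
    simp only [solV, spinorSq]; push_cast; field_simp
  rw [DiracAt, e1, e2]
  constructor
  · rintro ⟨h, h'⟩
    exact ⟨by linear_combination -h', by linear_combination h⟩
  · rintro ⟨h, h'⟩
    exact ⟨by linear_combination h', by linear_combination -h⟩

/-! ### Dirac, Weingarten and Codazzi equations of a surface. -/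

namespace SpinorSurface

variable {Ω : Set ℂ} {F : ℂ → Sol} {ψ₁ ψ₂ : ℂ → ℂ} (h : SpinorSurface Ω F ψ₁ ψ₂) {ζ : ℂ}
include h

/-- In the interior of {Z₃ = 0} one component is nonzero at the point, so the other vanishes on a
neighbourhood and has zero derivative. The equation without denominators for the nonzero component
then has zero right-hand side, each of its terms containing the vanishing component. -/
theorem solDirac : SolDirac Ω (meanCurvature F) ψ₁ ψ₂ := by
  refine ⟨fun ζ hζ => ?_, fun ζ hζ => ?_⟩
  · have hne := mul_ne_zero_iff.1 hζ.2
    exact (diracAt_iff hne.1 fun h0 => hne.2 (by rw [h0, map_zero])).2 (h.dirac hζ.1)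
  · have hev : ∀ᶠ w in nhds ζ, w ∈ Ω ∧ ψ₁ w * conj (ψ₂ w) = 0 := mem_interior_iff_mem_nhds.1 hζ
    obtain ⟨hζΩ, h0⟩ := hev.self_of_nhds
    obtain ⟨d1, d2⟩ := h.dirac hζΩ
    have hc : ∀ x : ℂ, conj x = 0 → x = 0 := fun x hx => by simpa using hx
    by_cases h1 : ψ₁ ζ = 0
    · have h2 : ψ₂ ζ ≠ 0 := (h.ne_zero ζ hζΩ).resolve_left fun hn => hn h1
      have hz : ψ₁ =ᶠ[nhds ζ] fun _ => 0 := by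
        filter_upwards [hev, (h.differentiableAt₂ hζΩ).continuousAt.eventually_ne h2] with w hw hw2
        exact (mul_eq_zero.1 hw.2).resolve_right fun hn => hw2 (hc _ hn)
      have hd : dzbar ψ₁ ζ = 0 := by rw [dzbar_congr hz, dzbar_const]
      rw [DiracAt, d2, hd, h1]
      simp
    · have h2 : ψ₂ ζ = 0 := hc _ ((mul_eq_zero.1 h0).resolve_left h1)
      have hz : ψ₂ =ᶠ[nhds ζ] fun _ => 0 := by
        filter_upwards [hev, (h.differentiableAt₁ hζΩ).continuousAt.eventually_ne h1] with w hw hw1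
        exact hc _ ((mul_eq_zero.1 hw.2).resolve_left hw1)
      have hd : dz ψ₂ ζ = 0 := by rw [dz_congr hz, dz_const]
      rw [DiracAt, d1, hd, h2]
      simp

theorem contDiffOn_spinorSq : ContDiffOn ℝ ∞ (fun w => spinorSq (ψ₁ w) (ψ₂ w)) Ω := by
  have e : (fun w => spinorSq (ψ₁ w) (ψ₂ w)) =
      fun w => (ψ₁ w).re ^ 2 + (ψ₁ w).im ^ 2 + (ψ₂ w).re ^ 2 + (ψ₂ w).im ^ 2 := by
    funext w; exact spinorSq_eq _ _
  have h₁ := h.generating.smooth₁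
  have h₂ := h.generating.smooth₂
  rw [e]
  exact ((((contDiffOn_re h₁).pow 2).add ((contDiffOn_im h₁).pow 2)).add
    ((contDiffOn_re h₂).pow 2)).add ((contDiffOn_im h₂).pow 2)

theorem logFactor_eq (hζ : ζ ∈ Ω) : logFactor F ζ = Real.log (spinorSq (ψ₁ ζ) (ψ₂ ζ)) := by
  rw [logFactor, h.firstForm_one_one hζ, Real.log_pow]
  push_cast
  ring

theorem exp_logFactor (hζ : ζ ∈ Ω) : Real.exp (logFactor F ζ) = spinorSq (ψ₁ ζ) (ψ₂ ζ) := by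
  rw [h.logFactor_eq hζ, Real.exp_log (spinorSq_pos (h.ne_zero ζ hζ))]

theorem contDiffOn_logFactor : ContDiffOn ℝ ∞ (logFactor F) Ω :=
  (h.contDiffOn_spinorSq.log fun w hw => (spinorSq_pos (h.ne_zero w hw)).ne').congr
    fun _ hw => h.logFactor_eq hw

theorem contDiffOn_hopfCoeff : ContDiffOn ℝ ∞ (hopfCoeff F) Ω := by
  have h₁ := h.generating.smooth₁
  have h₃ := contDiffOn_conj h.generating.smooth₂
  refine ContDiffOn.congr (f := fun w => (conj (ψ₂ w) * dz ψ₁ w -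
    ψ₁ w * dz (fun w => conj (ψ₂ w)) w) + 1 / 2 * (conj (ψ₂ w) ^ 4 - ψ₁ w ^ 4)) ?_
    fun w hw => h.hopfCoeff_eq hw
  exact ((h₃.mul (contDiffOn_dz h.isOpen h₁)).sub (h₁.mul (contDiffOn_dz h.isOpen h₃))).add
    (contDiffOn_const.mul ((h₃.pow 4).sub (h₁.pow 4)))

theorem contDiffOn_meanCurvature : ContDiffOn ℝ ∞ (meanCurvature F) Ω := by
  have h₁ := h.generating.smooth₁
  have h₂ := h.generating.smooth₂
  have hpos : ∀ w ∈ Ω, spinorSq (ψ₁ w) (ψ₂ w) ^ 2 ≠ 0 := fun w hw =>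
    (pow_pos (spinorSq_pos (h.ne_zero w hw)) 2).ne'
  refine ContDiffOn.congr (f := fun w => 2 * (conj (ψ₂ w) * dzbar ψ₁ w -
    conj (ψ₁ w) * dz ψ₂ w).re / spinorSq (ψ₁ w) (ψ₂ w) ^ 2) ?_
    fun w hw => by rw [eq_div_iff (hpos w hw), h.meanCurvature_eq hw]
  exact (contDiffOn_const.mul (contDiffOn_re
    (((contDiffOn_conj h₂).mul (contDiffOn_dzbar h.isOpen h₁)).sub
      ((contDiffOn_conj h₁).mul (contDiffOn_dz h.isOpen h₂))))).div
    (h.contDiffOn_spinorSq.pow 2) hpos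

/-- The remaining Weingarten equations, on the whole domain. -/
theorem weingarten (hζ : ζ ∈ Ω) :
    dz ψ₁ ζ = dz (fun w => (logFactor F w : ℂ)) ζ * ψ₁ ζ
        + hopfCoeff F ζ * (spinorSq (ψ₁ ζ) (ψ₂ ζ) : ℂ)⁻¹ * ψ₂ ζ - 1 / 2 * conj (ψ₂ ζ) ^ 3 ∧
      dzbar ψ₂ ζ = -conj (hopfCoeff F ζ) * (spinorSq (ψ₁ ζ) (ψ₂ ζ) : ℂ)⁻¹ * ψ₁ ζ
        + dzbar (fun w => (logFactor F w : ℂ)) ζ * ψ₂ ζ - 1 / 2 * conj (ψ₁ ζ) ^ 3 := by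
  have hr := spinorSq_pos (h.ne_zero ζ hζ)
  have hr' : (spinorSq (ψ₁ ζ) (ψ₂ ζ) : ℂ) ≠ 0 := by exact_mod_cast hr.ne'
  have hd₁ := h.differentiableAt₁ hζ
  have hd₂ := h.differentiableAt₂ hζ
  have hc₁ := differentiableAt_conj hd₁
  have hc₂ := differentiableAt_conj hd₂
  -- Differentiating ρ = e^α gives a second linear relation, besides that for A, between ∂ψ₁ and the
  -- conjugate of ∂̄ψ₂. The determinant is −ρ.
  have hα : (spinorSq (ψ₁ ζ) (ψ₂ ζ) : ℂ) * dz (fun w => (logFactor F w : ℂ)) ζ =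
      dz ψ₁ ζ * conj (ψ₁ ζ) + ψ₁ ζ * conj (dzbar ψ₁ ζ) + (dz ψ₂ ζ * conj (ψ₂ ζ)
        + ψ₂ ζ * conj (dzbar ψ₂ ζ)) := by
    have he : (fun w => (logFactor F w : ℂ)) =ᶠ[nhds ζ]
        fun w => (Real.log (spinorSq (ψ₁ w) (ψ₂ w)) : ℂ) := by
      filter_upwards [h.isOpen.mem_nhds hζ] with w hw
      rw [h.logFactor_eq hw]
    rw [dz_congr he, dz_log (h.contDiffOn_spinorSq.differentiableAt_of_isOpen h.isOpen hζ) hr.ne']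
    simp only [ofReal_spinorSq]
    rw [dz_add (hd₁.fun_mul hc₁) (hd₂.fun_mul hc₂), dz_mul hd₁ hc₁, dz_mul hd₂ hc₂, dz_conj hd₁,
      dz_conj hd₂]
  have hA := h.hopfCoeff_eq hζ
  rw [dz_conj hd₂] at hA
  obtain ⟨d1, d2⟩ := h.dirac hζ
  have hrr := ofReal_spinorSq (ψ₁ ζ) (ψ₂ ζ)
  have d1' := congrArg conj d1
  simp only [map_add, map_mul, map_pow, Complex.conj_conj, Complex.conj_ofReal, map_div₀, map_one,
    map_ofNat] at d1'
  rw [d1', d2] at hα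
  -- The unknown in the linear system is conj (∂̄ψ₂), so its equation is solved first and conjugated
  -- afterwards.
  have w2 : conj (dzbar ψ₂ ζ) = -hopfCoeff F ζ * (spinorSq (ψ₁ ζ) (ψ₂ ζ) : ℂ)⁻¹ * conj (ψ₁ ζ)
        + dz (fun w => (logFactor F w : ℂ)) ζ * conj (ψ₂ ζ) - 1 / 2 * ψ₁ ζ ^ 3 := by
    apply mul_left_cancel₀ hr'
    rw [hA]
    field_simp
    linear_combination (2 * conj (dzbar ψ₂ ζ) + ψ₁ ζ ^ 3) * hrr - 2 * conj (ψ₂ ζ) * hα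
  constructor
  · apply mul_left_cancel₀ hr'
    rw [hA]
    field_simp
    linear_combination (2 * dz ψ₁ ζ + conj (ψ₂ ζ) ^ 3) * hrr - 2 * ψ₁ ζ * hα
  · have := congrArg conj w2
    rw [Complex.conj_conj] at this
    rw [this, dzbar_ofReal (h.contDiffOn_logFactor.differentiableAt_of_isOpen h.isOpen hζ)]
    simp [Complex.conj_ofNat]

/-- The **Codazzi equations**. -/
theorem codazzi (hζ : ζ ∈ Ω) :
    dzbar (dz (fun w => (logFactor F w : ℂ))) ζ
        - hopfCoeff F ζ * conj (hopfCoeff F ζ) / (spinorSq (ψ₁ ζ) (ψ₂ ζ) : ℂ) ^ 2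
        + 1 / 4 * (spinorSq (ψ₁ ζ) (ψ₂ ζ) : ℂ) ^ 2 * (meanCurvature F ζ : ℂ) ^ 2 =
      1 / 4 * (6 * (ψ₁ ζ * conj (ψ₁ ζ)) * (ψ₂ ζ * conj (ψ₂ ζ)) -
        ((ψ₁ ζ * conj (ψ₁ ζ)) ^ 2 + (ψ₂ ζ * conj (ψ₂ ζ)) ^ 2)) ∧
    dzbar (hopfCoeff F) ζ
        - 1 / 2 * dz (fun w => (meanCurvature F w : ℂ)) ζ * (spinorSq (ψ₁ ζ) (ψ₂ ζ) : ℂ) ^ 2 =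
      ((ψ₂ ζ * conj (ψ₂ ζ)) ^ 2 - (ψ₁ ζ * conj (ψ₁ ζ)) ^ 2) * (ψ₁ ζ * conj (ψ₂ ζ)) := by
  have hne : ∀ w ∈ Ω, (spinorSq (ψ₁ w) (ψ₂ w) : ℂ) ≠ 0 := fun w hw => by
    exact_mod_cast (spinorSq_pos (h.ne_zero w hw)).ne'
  -- the coefficient functions of the Dirac and Weingarten equations
  set R : ℂ → ℂ := fun w => (spinorSq (ψ₁ w) (ψ₂ w) : ℂ) with hR
  set g : ℂ → ℝ := fun w => meanCurvature F w / 2 * spinorSq (ψ₁ w) (ψ₂ w) with hg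
  set β : ℂ → ℂ := fun w => hopfCoeff F w * (R w)⁻¹ with hβ
  set α' : ℂ → ℂ := dz fun w => (logFactor F w : ℂ) with hα'
  have sα := contDiffOn_ofReal h.contDiffOn_logFactor
  have sR : ContDiffOn ℝ ∞ R Ω := contDiffOn_ofReal h.contDiffOn_spinorSq
  have sg : ContDiffOn ℝ ∞ g Ω := (h.contDiffOn_meanCurvature.div_const 2).mul h.contDiffOn_spinorSq
  have sβ : ContDiffOn ℝ ∞ β Ω := h.contDiffOn_hopfCoeff.mul (sR.inv hne)
  have sα' : ContDiffOn ℝ ∞ α' Ω := contDiffOn_dz h.isOpen sα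
  have d₁ := h.differentiableAt₁ hζ
  have d₂ := h.differentiableAt₂ hζ
  have c₁ := differentiableAt_conj d₁
  have c₂ := differentiableAt_conj d₂
  have dR := sR.differentiableAt_of_isOpen h.isOpen hζ
  have dg := sg.differentiableAt_of_isOpen h.isOpen hζ
  have dg' := differentiableAt_ofReal dg
  have dβ := sβ.differentiableAt_of_isOpen h.isOpen hζ
  have dβ' := differentiableAt_conj dβ
  have dα' := sα'.differentiableAt_of_isOpen h.isOpen hζ
  have dα'' : DifferentiableAt ℝ (fun w => conj (α' w)) ζ := differentiableAt_conj dα'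
  have dH := h.contDiffOn_meanCurvature.differentiableAt_of_isOpen h.isOpen hζ
  have dH' := differentiableAt_ofReal dH
  -- the equations near the point
  have e1 : dz ψ₁ =ᶠ[nhds ζ] fun w => (α' w * ψ₁ w + β w * ψ₂ w) -
      1 / 2 * (conj (ψ₂ w) * conj (ψ₂ w) * conj (ψ₂ w)) := by
    filter_upwards [h.isOpen.mem_nhds hζ] with w hw
    rw [(h.weingarten hw).1]; ring
  have e2 : dzbar ψ₁ =ᶠ[nhds ζ] fun w => (g w : ℂ) * ψ₂ w +
      1 / 2 * (conj (ψ₁ w) * conj (ψ₁ w) * conj (ψ₂ w)) := by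
    filter_upwards [h.isOpen.mem_nhds hζ] with w hw
    rw [(h.dirac hw).1]; ring
  have e3 : dzbar ψ₂ =ᶠ[nhds ζ] fun w => (conj (α' w) * ψ₂ w - conj (β w) * ψ₁ w) -
      1 / 2 * (conj (ψ₁ w) * conj (ψ₁ w) * conj (ψ₁ w)) := by
    filter_upwards [h.isOpen.mem_nhds hζ] with w hw
    rw [(h.weingarten hw).2,
      dzbar_ofReal (h.contDiffOn_logFactor.differentiableAt_of_isOpen h.isOpen hw)]
    simp only [hβ, hR, map_mul, map_inv₀, Complex.conj_ofReal]
    ring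
  have e4 : dz ψ₂ =ᶠ[nhds ζ] fun w => 1 / 2 * (conj (ψ₂ w) * conj (ψ₂ w) * conj (ψ₁ w)) -
      (g w : ℂ) * ψ₁ w := by
    filter_upwards [h.isOpen.mem_nhds hζ] with w hw
    rw [(h.dirac hw).2]; ring
  have c₂₂ := c₂.fun_mul c₂
  have c₁₁ := c₁.fun_mul c₁
  -- compatibility of the equations for `ψ₁`
  have E := dzbar_dz_comm h.isOpen h.generating.smooth₁ hζ
  rw [dzbar_congr e1, dz_congr e2,
    dzbar_sub ((dα'.fun_mul d₁).fun_add (dβ.fun_mul d₂)) ((c₂₂.fun_mul c₂).const_mul _),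
    dzbar_add (dα'.fun_mul d₁) (dβ.fun_mul d₂), dzbar_mul dα' d₁, dzbar_mul dβ d₂,
    dzbar_const_mul _ (c₂₂.fun_mul c₂), dzbar_mul c₂₂ c₂, dzbar_mul c₂ c₂,
    dz_add (dg'.fun_mul d₂) ((c₁₁.fun_mul c₂).const_mul _), dz_mul dg' d₂,
    dz_const_mul _ (c₁₁.fun_mul c₂), dz_mul c₁₁ c₂, dz_mul c₁ c₁,
    dz_conj d₁, dz_conj d₂, dzbar_conj d₂,
    e2.eq_of_nhds, e3.eq_of_nhds, e4.eq_of_nhds] at E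
  -- compatibility of the equations for `ψ₂`
  have E' := dzbar_dz_comm h.isOpen h.generating.smooth₂ hζ
  rw [dzbar_congr e4, dz_congr e3,
    dzbar_sub ((c₂₂.fun_mul c₁).const_mul _) (dg'.fun_mul d₁),
    dzbar_const_mul _ (c₂₂.fun_mul c₁), dzbar_mul c₂₂ c₁, dzbar_mul c₂ c₂, dzbar_mul dg' d₁,
    dz_sub ((dα''.fun_mul d₂).fun_sub (dβ'.fun_mul d₁)) ((c₁₁.fun_mul c₁).const_mul _),
    dz_sub (dα''.fun_mul d₂) (dβ'.fun_mul d₁), dz_mul dα'' d₂, dz_mul dβ' d₁,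
    dz_const_mul _ (c₁₁.fun_mul c₁), dz_mul c₁₁ c₁, dz_mul c₁ c₁,
    dz_conj d₁, dz_conj dβ, dz_conj dα', dzbar_conj d₁, dzbar_conj d₂, dzbar_ofReal dg,
    e1.eq_of_nhds, e2.eq_of_nhds, e4.eq_of_nhds] at E'
  -- The function α is real, so α_{z z̄} is real; this lets the conjugate of E' contain the same
  -- unknown as E.
  have hL : conj (dzbar α' ζ) = dzbar α' ζ := by
    have h1 : dzbar (fun w => (logFactor F w : ℂ)) =ᶠ[nhds ζ] fun w => conj (α' w) := by
      filter_upwards [h.isOpen.mem_nhds hζ] with w hw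
      exact dzbar_ofReal (h.contDiffOn_logFactor.differentiableAt_of_isOpen h.isOpen hw)
    rw [← dz_conj dα', ← dz_congr h1, hα', dzbar_dz_comm h.isOpen sα hζ]
  replace E' := congrArg conj E'
  simp only [map_add, map_sub, map_mul, map_div₀, map_one, map_ofNat, Complex.conj_conj,
    Complex.conj_ofReal, hL] at E E'
  -- derivatives of the length of the spinor, of the Hopf differential and of the mean curvature
  have hRz : dz R ζ = R ζ * α' ζ := by
    have h1 : (fun w => (logFactor F w : ℂ)) =ᶠ[nhds ζ]
        fun w => (Real.log (spinorSq (ψ₁ w) (ψ₂ w)) : ℂ) := by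
      filter_upwards [h.isOpen.mem_nhds hζ] with w hw
      rw [h.logFactor_eq hw]
    rw [hα', dz_congr h1, ← dz_log (h.contDiffOn_spinorSq.differentiableAt_of_isOpen h.isOpen hζ)
      (spinorSq_pos (h.ne_zero ζ hζ)).ne']
  have hRzb : dzbar R ζ = R ζ * conj (α' ζ) := by
    rw [dzbar_ofReal (h.contDiffOn_spinorSq.differentiableAt_of_isOpen h.isOpen hζ)]
    change conj (dz R ζ) = _
    rw [hRz, map_mul, Complex.conj_ofReal]
  have hA : hopfCoeff F =ᶠ[nhds ζ] fun w => β w * R w := by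
    filter_upwards [h.isOpen.mem_nhds hζ] with w hw
    rw [hβ, inv_mul_cancel_right₀ (hne w hw)]
  have hAz : dzbar (hopfCoeff F) ζ = dzbar β ζ * R ζ + β ζ * (R ζ * conj (α' ζ)) := by
    rw [dzbar_congr hA, dzbar_mul dβ dR, hRzb]
  have hgz : dz (fun w => (g w : ℂ)) ζ = 1 / 2 * (dz (fun w => (meanCurvature F w : ℂ)) ζ * R ζ +
      meanCurvature F ζ * (R ζ * α' ζ)) := by
    have h1 : (fun w => (g w : ℂ)) = fun w => 1 / 2 * ((meanCurvature F w : ℂ) * R w) := by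
      funext w; simp only [hg, hR]; push_cast; ring
    rw [h1, dz_const_mul _ (dH'.fun_mul dR), dz_mul dH' dR, hRz]
  have hgζ : (g ζ : ℂ) = 1 / 2 * (meanCurvature F ζ * R ζ) := by
    simp only [hg, hR]; push_cast; ring
  have hrr : R ζ = ψ₁ ζ * conj (ψ₁ ζ) + ψ₂ ζ * conj (ψ₂ ζ) := ofReal_spinorSq _ _
  have hβc : conj (hopfCoeff F ζ) = conj (β ζ) * R ζ := by
    rw [hA.eq_of_nhds, map_mul]; congr 1; exact Complex.conj_ofReal _
  have hR0 : R ζ ≠ 0 := hne ζ hζ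
  have hX : hopfCoeff F ζ * conj (hopfCoeff F ζ) / R ζ ^ 2 = β ζ * conj (β ζ) := by
    rw [hβc, hA.eq_of_nhds]; field_simp
  have hg2 : 1 / 4 * R ζ ^ 2 * (meanCurvature F ζ : ℂ) ^ 2 = (g ζ : ℂ) ^ 2 := by rw [hgζ]; ring
  have hY : dzbar (hopfCoeff F) ζ - 1 / 2 * dz (fun w => (meanCurvature F w : ℂ)) ζ * R ζ ^ 2 =
      R ζ * (dzbar β ζ + β ζ * conj (α' ζ) - dz (fun w => (g w : ℂ)) ζ + g ζ * α' ζ) := by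
    rw [hAz, hgz, hgζ]; ring
  change _ - hopfCoeff F ζ * conj (hopfCoeff F ζ) / R ζ ^ 2 + 1 / 4 * R ζ ^ 2 *
    (meanCurvature F ζ : ℂ) ^ 2 = _ ∧ _ - _ * R ζ ^ 2 = _
  rw [hX, hg2, hY]
  -- Put X = α_{z z̄} − |β|² + g² and Y = β_{z̄} + β α_{z̄} − g_z + g α_z. Up to terms polynomial in
  -- ψ and ψ̄, E reads ψ₁X + ψ₂Y = 0 and the conjugated E' reads −ψ̄₂X + ψ̄₁Y = 0. The two
  -- combinations below isolate ρX and ρY.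
  clear_value R g β α'
  constructor
  · apply mul_left_cancel₀ hR0
    rw [hrr]
    linear_combination conj (ψ₁ ζ) * E - ψ₂ ζ * E'
  · rw [hrr]
    linear_combination conj (ψ₂ ζ) * E + ψ₁ ζ * E'

end SpinorSurface

/-! # Solutions of the Dirac equations generate surfaces -/

/-- Density of C ∪ B₀: if u is nonzero at a point, it is nonzero nearby, so the neighbourhood misses
C and the point lies in B₀. -/
theorem eq_zero_of_regularSet_of_flatSet {D : Set ℂ} (hD : IsOpen D) {ψ₁ ψ₂ u : ℂ → ℂ}
    (hu : ContinuousOn u D) (hreg : ∀ ζ ∈ regularSet D ψ₁ ψ₂, u ζ = 0)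
    (hflat : ∀ ζ ∈ flatSet D ψ₁ ψ₂, u ζ = 0) : ∀ ζ ∈ D, u ζ = 0 := by
  intro ζ hζ
  by_contra hne
  refine hne (hflat ζ (mem_interior_iff_mem_nhds.2 ?_))
  filter_upwards [(hu.continuousAt (hD.mem_nhds hζ)).eventually_ne hne, hD.mem_nhds hζ] with w hw hwD
  by_contra hn
  exact hw (hreg w ⟨hwD, fun h0 => hn ⟨hwD, h0⟩⟩)

/-- The prescribed H need not be continuous, so the Dirac equation itself cannot be passed to the
limit on the boundary of {Z₃ = 0}. These two consequences are free of H and have continuous sides.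
-/
theorem structure_of_solDirac {D : Set ℂ} (hD : IsOpen D) {ψ₁ ψ₂ : ℂ → ℂ} {H : ℂ → ℝ}
    (h₁ : ContDiffOn ℝ ∞ ψ₁ D) (h₂ : ContDiffOn ℝ ∞ ψ₂ D)
    (hne : ∀ ζ ∈ D, ψ₁ ζ ≠ 0 ∨ ψ₂ ζ ≠ 0) (hS : SolDirac D H ψ₁ ψ₂) {ζ : ℂ} (hζ : ζ ∈ D) :
    ψ₁ ζ * dzbar ψ₁ ζ + ψ₂ ζ * dz ψ₂ ζ =
        1 / 2 * conj (ψ₁ ζ) * conj (ψ₂ ζ) * spinorSq (ψ₁ ζ) (ψ₂ ζ) ∧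
      (conj (ψ₂ ζ) * dzbar ψ₁ ζ - conj (ψ₁ ζ) * dz ψ₂ ζ).im = 0 := by
  have hreg : ∀ ζ ∈ regularSet D ψ₁ ψ₂, ψ₁ ζ * dzbar ψ₁ ζ + ψ₂ ζ * dz ψ₂ ζ =
        1 / 2 * conj (ψ₁ ζ) * conj (ψ₂ ζ) * spinorSq (ψ₁ ζ) (ψ₂ ζ) ∧
      (conj (ψ₂ ζ) * dzbar ψ₁ ζ - conj (ψ₁ ζ) * dz ψ₂ ζ).im = 0 := by
    intro ζ hζ
    have hn := mul_ne_zero_iff.1 hζ.2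
    exact (spinor_solve_iff (hne ζ hζ.1)).2
      ⟨_, (diracAt_iff hn.1 fun h0 => hn.2 (by rw [h0, map_zero])).1 (hS.1 ζ hζ)⟩
  have hflat : ∀ ζ ∈ flatSet D ψ₁ ψ₂, ψ₁ ζ * dzbar ψ₁ ζ + ψ₂ ζ * dz ψ₂ ζ =
        1 / 2 * conj (ψ₁ ζ) * conj (ψ₂ ζ) * spinorSq (ψ₁ ζ) (ψ₂ ζ) ∧
      (conj (ψ₂ ζ) * dzbar ψ₁ ζ - conj (ψ₁ ζ) * dz ψ₂ ζ).im = 0 := by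
    intro ζ hζ
    obtain ⟨d1, d2⟩ := hS.2 ζ hζ
    have e1 : dz ψ₂ ζ = 0 := by linear_combination d1
    have e2 : dzbar ψ₁ ζ = 0 := by linear_combination -d2
    have h0 : ψ₁ ζ * conj (ψ₂ ζ) = 0 := (interior_subset hζ).2
    have h0' : conj (ψ₁ ζ) * conj (ψ₂ ζ) = 0 := by
      rcases mul_eq_zero.1 h0 with h | h
      · rw [h, map_zero, zero_mul]
      · rw [h, mul_zero]
    rw [e1, e2, mul_assoc (1 / 2 : ℂ), h0']
    simp
  have s₁ := contDiffOn_conj h₁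
  have s₂ := contDiffOn_conj h₂
  have t₁ := contDiffOn_dzbar hD h₁
  have t₂ := contDiffOn_dz hD h₂
  have u₁ : ContDiffOn ℝ ∞ (fun ζ => (ψ₁ ζ * dzbar ψ₁ ζ + ψ₂ ζ * dz ψ₂ ζ) - 1 / 2 * conj (ψ₁ ζ) *
      conj (ψ₂ ζ) * (ψ₁ ζ * conj (ψ₁ ζ) + ψ₂ ζ * conj (ψ₂ ζ))) D :=
    ((h₁.mul t₁).add (h₂.mul t₂)).sub
      (((contDiffOn_const.mul s₁).mul s₂).mul ((h₁.mul s₁).add (h₂.mul s₂)))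
  have u₂ : ContDiffOn ℝ ∞
      (fun ζ => ((conj (ψ₂ ζ) * dzbar ψ₁ ζ - conj (ψ₁ ζ) * dz ψ₂ ζ).im : ℂ)) D :=
    contDiffOn_ofReal (contDiffOn_im ((s₂.mul t₁).sub (s₁.mul t₂)))
  constructor
  · have := eq_zero_of_regularSet_of_flatSet hD u₁.continuousOn (ψ₁ := ψ₁) (ψ₂ := ψ₂)
      (fun w hw => by rw [(hreg w hw).1, ofReal_spinorSq, sub_self])
      (fun w hw => by rw [(hflat w hw).1, ofReal_spinorSq, sub_self]) ζ hζ
    rw [ofReal_spinorSq]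
    exact sub_eq_zero.1 this
  · have := eq_zero_of_regularSet_of_flatSet hD u₂.continuousOn (ψ₁ := ψ₁) (ψ₂ := ψ₂)
      (fun w hw => by rw [(hreg w hw).2, Complex.ofReal_zero])
      (fun w hw => by rw [(hflat w hw).2, Complex.ofReal_zero]) ζ hζ
    exact_mod_cast this

theorem exists_smooth_primitive {D : Set ℂ} (hD : IsOpen D) (hsc : SimplyConnectedSpace D)
    {p q : ℂ → ℝ} (hp : ContDiffOn ℝ ∞ p D) (hq : ContDiffOn ℝ ∞ q D)
    (h : ∀ ζ ∈ D, fderiv ℝ p ζ Complex.I = fderiv ℝ q ζ 1) (P : ℂ) (c : ℝ) :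
    ∃ f : ℂ → ℝ, f P = c ∧ ContDiffOn ℝ ∞ f D ∧
      ∀ ζ ∈ D, fderiv ℝ f ζ 1 = p ζ ∧ fderiv ℝ f ζ Complex.I = q ζ := by
  obtain ⟨f, hf⟩ := exists_primitive_plane hD hsc (hp.differentiableOn (by simp))
    (hq.differentiableOn (by simp)) h
  have hf' : ∀ ζ ∈ D, HasFDerivAt (fun w => f w + (c - f P))
      (p ζ • Complex.reCLM + q ζ • Complex.imCLM) ζ := fun ζ hζ => (hf ζ hζ).add_const _
  refine ⟨fun w => f w + (c - f P), by ring, ?_, fun ζ hζ => ?_⟩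
  · rw [contDiffOn_infty_iff_fderiv_of_isOpen hD]
    refine ⟨fun ζ hζ => (hf' ζ hζ).differentiableAt.differentiableWithinAt, ?_⟩
    exact ContDiffOn.congr ((hp.smul contDiffOn_const).add (hq.smul contDiffOn_const))
      fun ζ hζ => (hf' ζ hζ).fderiv
  · rw [(hf' ζ hζ).fderiv]
    simp

theorem fderiv_re_sub_fderiv_im {u : ℂ → ℂ} {ζ : ℂ} (hu : DifferentiableAt ℝ u ζ) :
    fderiv ℝ (fun w => 2 * (u w).re) ζ Complex.I - fderiv ℝ (fun w => -2 * (u w).im) ζ 1 =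
      4 * (dzbar u ζ).im := by
  rw [fderiv_const_mul (differentiableAt_re hu), fderiv_const_mul (differentiableAt_im hu)]
  simp only [smul_apply, fderiv_re_apply hu, fderiv_im_apply hu, fderiv_apply_one, fderiv_apply_I,
    smul_eq_mul]
  simp
  ring

/-- The diagonal entries e^{−z} and e^z are mutually inverse, so their logarithmic derivatives are
opposite and F⁻¹∂ᵥF lies in the Lie algebra. -/
theorem leftDeriv_eq_velocity {F : ℂ → Sol} {ζ : ℂ}
    (hF : DifferentiableAt ℝ (fun w => Sol.toMat (F w) 1 1) ζ) (v : ℂ) : leftDeriv F v ζ =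
      !![-velocity F v ζ 2, 0, velocity F v ζ 0; 0, velocity F v ζ 2, velocity F v ζ 1; 0, 0, 0] := by
  have hne : Sol.toMat (F ζ) 1 1 ≠ 0 := (toMat_pos _).ne'
  have hinv : HasFDerivAt (fun w => (Sol.toMat (F w) 1 1)⁻¹)
      (-((Sol.toMat (F ζ) 1 1) ^ 2)⁻¹ • fderiv ℝ (fun w => Sol.toMat (F w) 1 1) ζ) ζ :=
    (hasDerivAt_inv hne).comp_hasFDerivAt ζ hF.hasFDerivAt
  have h00 : Sol.toMat (F ζ) 1 1 * fderiv ℝ (fun w => Sol.toMat (F w) 0 0) ζ v =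
      -((Sol.toMat (F ζ) 1 1)⁻¹ * fderiv ℝ (fun w => Sol.toMat (F w) 1 1) ζ v) := by
    simp only [toMat_zero_zero]
    rw [hinv.fderiv, smul_apply, smul_eq_mul]
    field_simp
  rw [leftDeriv_eq, velocity_eq, h00]
  simp

theorem fderiv_toMat_apply {F : ℂ → Sol} {ζ : ℂ}
    (hF : ∀ i j, DifferentiableAt ℝ (fun w => Sol.toMat (F w) i j) ζ) (v : ℂ) (i j : Fin 3) :
    fderiv ℝ (fun ζ (i j : Fin 3) => Sol.toMat (F ζ) i j) ζ v i j =
      fderiv ℝ (fun w => Sol.toMat (F w) i j) ζ v := by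
  rw [fderiv_pi fun i => differentiableAt_pi.2 (hF i)]
  simp only [ContinuousLinearMap.pi_apply]
  rw [fderiv_pi (hF i)]
  rfl

theorem contDiffOn_toMat_iff {D : Set ℂ} {F : ℂ → Sol} :
    ContDiffOn ℝ ∞ (fun ζ (i j : Fin 3) => Sol.toMat (F ζ) i j) D ↔
      ∀ i j, ContDiffOn ℝ ∞ (fun ζ => Sol.toMat (F ζ) i j) D := by
  rw [contDiffOn_pi]
  exact forall_congr' fun i => contDiffOn_pi

/-- Isotropy of Z makes F_x and F_y orthogonal of equal length ρ > 0; pairing a vanishing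
combination of them with each one shows that they are independent. -/
theorem SpinorSurface.isConformalSurfaceOn {D : Set ℂ} {F : ℂ → Sol} {ψ₁ ψ₂ : ℂ → ℂ}
    (h : SpinorSurface D F ψ₁ ψ₂) : IsConformalSurfaceOn D F := by
  have hconf : IsConformalOn D F := by
    intro ζ hζ
    simp only [firstForm, dotProduct, Fin.sum_univ_three, (h.generating.velocity hζ _).1,
      (h.generating.velocity hζ _).2, spinorVec_re, spinorVec_im, Matrix.cons_val]
    constructor <;> ring
  refine ⟨contDiffOn_toMat_iff.2 h.smooth, fun ζ hζ => ?_, hconf⟩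
  rw [injective_iff_map_eq_zero]
  intro v hv
  have h0 : ∀ i j, fderiv ℝ (fun w => Sol.toMat (F w) i j) ζ v = 0 := by
    intro i j
    rw [← fderiv_toMat_apply fun i j => (h.smooth i j).differentiableAt_of_isOpen h.isOpen hζ, hv]
    rfl
  have hv0 : velocity F v ζ = 0 := by
    rw [velocity_eq, h0, h0, h0]
    ext k; fin_cases k <;> simp
  have hlin : velocity F v ζ = v.re • velocity F 1 ζ + v.im • velocity F Complex.I ζ := by
    have hL : ∀ L : ℂ →L[ℝ] ℝ, L v = v.re * L 1 + v.im * L Complex.I := by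
      intro L
      conv_lhs => rw [← Complex.re_add_im v]
      have : (v.re : ℂ) + v.im * Complex.I = v.re • (1 : ℂ) + v.im • Complex.I := by simp
      rw [this, map_add, map_smul, map_smul, smul_eq_mul, smul_eq_mul]
    simp only [velocity_eq]
    rw [hL (fderiv ℝ (fun w => Sol.toMat (F w) 0 2) ζ), hL (fderiv ℝ (fun w => Sol.toMat (F w) 1 2) ζ),
      hL (fderiv ℝ (fun w => Sol.toMat (F w) 1 1) ζ)]
    ext k; fin_cases k <;> simp <;> ring
  have hpos : 0 < firstForm F 1 1 ζ := by
    rw [h.firstForm_one_one hζ]; exact pow_pos (spinorSq_pos (h.ne_zero ζ hζ)) 2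
  obtain ⟨c1, c2⟩ := hconf ζ hζ
  rw [hv0] at hlin
  have r1 : v.re * firstForm F 1 1 ζ = 0 := by
    have := congrArg (fun x => velocity F 1 ζ ⬝ᵥ x) hlin
    simp only [dotProduct_add, dotProduct_smul, dotProduct_zero, smul_eq_mul] at this
    change 0 = v.re * firstForm F 1 1 ζ + v.im * firstForm F 1 Complex.I ζ at this
    rw [this, c2]; ring
  have r2 : v.im * firstForm F 1 1 ζ = 0 := by
    have := congrArg (fun x => x ⬝ᵥ velocity F Complex.I ζ) hlin
    simp only [add_dotProduct, smul_dotProduct, zero_dotProduct, smul_eq_mul] at this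
    change 0 = v.re * firstForm F 1 Complex.I ζ + v.im * firstForm F Complex.I Complex.I ζ at this
    rw [c1, this, c2]; ring
  exact Complex.ext ((mul_eq_zero.1 r1).resolve_right hpos.ne')
    ((mul_eq_zero.1 r2).resolve_right hpos.ne')

theorem exists_spinorSurface {D : Set ℂ} (hD : IsOpen D) (hsc : SimplyConnectedSpace D)
    {ψ₁ ψ₂ : ℂ → ℂ} {H : ℂ → ℝ} (h₁ : ContDiffOn ℝ ∞ ψ₁ D) (h₂ : ContDiffOn ℝ ∞ ψ₂ D)
    (hne : ∀ ζ ∈ D, ψ₁ ζ ≠ 0 ∨ ψ₂ ζ ≠ 0) (hS : SolDirac D H ψ₁ ψ₂) (P : ℂ) (g : Sol) :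
    ∃ F : ℂ → Sol, F P = g ∧ SpinorSurface D F ψ₁ ψ₂ := by
  set a : Fin 3 → ℂ → ℝ := fun k w => 2 * (spinorVec (ψ₁ w) (ψ₂ w) k).re with ha
  set b : Fin 3 → ℂ → ℝ := fun k w => -2 * (spinorVec (ψ₁ w) (ψ₂ w) k).im with hb
  have sZ : ∀ k, ContDiffOn ℝ ∞ (fun w => spinorVec (ψ₁ w) (ψ₂ w) k) D := by
    have h₃ := contDiffOn_conj h₂
    intro k
    fin_cases k
    · exact contDiffOn_const.mul ((h₃.pow 2).add (h₁.pow 2))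
    · exact contDiffOn_const.mul ((h₃.pow 2).sub (h₁.pow 2))
    · exact h₁.mul h₃
  have sa : ∀ k, ContDiffOn ℝ ∞ (a k) D := fun k => contDiffOn_const.mul (contDiffOn_re (sZ k))
  have sb : ∀ k, ContDiffOn ℝ ∞ (b k) D := fun k => contDiffOn_const.mul (contDiffOn_im (sZ k))
  have hab : ∀ ζ ∈ D,
      fderiv ℝ (a 0) ζ Complex.I - fderiv ℝ (b 0) ζ 1 = b 2 ζ * a 0 ζ - a 2 ζ * b 0 ζ ∧
      fderiv ℝ (a 1) ζ Complex.I - fderiv ℝ (b 1) ζ 1 = -(b 2 ζ * a 1 ζ - a 2 ζ * b 1 ζ) ∧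
      fderiv ℝ (a 2) ζ Complex.I - fderiv ℝ (b 2) ζ 1 = 0 := by
    intro ζ hζ
    have key : ∀ k, fderiv ℝ (a k) ζ Complex.I - fderiv ℝ (b k) ζ 1 =
        4 * (spinorVar (ψ₁ ζ) (ψ₂ ζ) (dzbar ψ₁ ζ) (conj (dz ψ₂ ζ)) k).im := by
      intro k
      rw [← dzbar_spinorVec (h₁.differentiableAt_of_isOpen hD hζ)
        (h₂.differentiableAt_of_isOpen hD hζ),
        ← fderiv_re_sub_fderiv_im ((sZ k).differentiableAt_of_isOpen hD hζ)]
    simp only [key]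
    exact (spinor_structure_iff _ _ _ _).2 (structure_of_solDirac hD h₁ h₂ hne hS hζ)
  obtain ⟨x₀, y₀, z₀, rfl⟩ := exists_eq_solElt g
  -- The third component of F⁻¹dF is dz and is closed. The other two are e^z dx and e^{−z} dy; once
  -- z is known, multiplying them by e^{−z} and e^z makes them closed.
  obtain ⟨z, hzP, sz, hz⟩ := exists_smooth_primitive hD hsc (sa 2) (sb 2)
    (fun ζ hζ => sub_eq_zero.1 (hab ζ hζ).2.2) P z₀
  have hexp : ∀ (s : ℝ) (c : ℂ → ℝ) (ζ v : ℂ), ζ ∈ D → ContDiffOn ℝ ∞ c D →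
      fderiv ℝ (fun w => Real.exp (s * z w) * c w) ζ v =
        Real.exp (s * z ζ) * (s * fderiv ℝ z ζ v * c ζ + fderiv ℝ c ζ v) := by
    intro s c ζ v hζ hc
    have e1 : HasFDerivAt (fun w => Real.exp (s * z w))
        (Real.exp (s * z ζ) • s • fderiv ℝ z ζ) ζ :=
      ((sz.differentiableAt_of_isOpen hD hζ).hasFDerivAt.const_mul s).exp
    rw [fderiv_fun_mul e1.differentiableAt (hc.differentiableAt_of_isOpen hD hζ), e1.fderiv]
    simp only [add_apply, smul_apply, smul_eq_mul]
    ring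
  have sexp : ∀ s : ℝ, ContDiffOn ℝ ∞ (fun w => Real.exp (s * z w)) D := fun s =>
    (contDiffOn_const.mul sz).exp
  obtain ⟨x, hxP, sx, hx⟩ := exists_smooth_primitive hD hsc ((sexp (-1)).mul (sa 0))
    ((sexp (-1)).mul (sb 0)) (fun ζ hζ => by
      rw [hexp _ _ _ _ hζ (sa 0), hexp _ _ _ _ hζ (sb 0), (hz ζ hζ).1, (hz ζ hζ).2]
      linear_combination Real.exp (-1 * z ζ) * (hab ζ hζ).1) P x₀
  obtain ⟨y, hyP, sy, hy⟩ := exists_smooth_primitive hD hsc ((sexp 1).mul (sa 1))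
    ((sexp 1).mul (sb 1)) (fun ζ hζ => by
      rw [hexp _ _ _ _ hζ (sa 1), hexp _ _ _ _ hζ (sb 1), (hz ζ hζ).1, (hz ζ hζ).2]
      linear_combination Real.exp (1 * z ζ) * (hab ζ hζ).2.1) P y₀
  refine ⟨fun ζ => solElt (x ζ) (y ζ) (z ζ), by simp only [hxP, hyP, hzP], hD, ?_, ⟨h₁, h₂, ?_⟩, hne⟩
  · intro i j
    simp only [toMat_solElt]
    fin_cases i <;> fin_cases j <;> simp [solMatrix] <;>
      first
        | exact contDiffOn_const
        | assumption
        | exact sz.exp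
        | exact sz.neg.exp
  · intro ζ hζ
    have dz' := sz.differentiableAt_of_isOpen hD hζ
    have h11 : HasFDerivAt (fun w => Real.exp (z w)) (Real.exp (z ζ) • fderiv ℝ z ζ) ζ :=
      dz'.hasFDerivAt.exp
    have hv1 : velocity (fun ζ => solElt (x ζ) (y ζ) (z ζ)) 1 ζ = fun k => a k ζ := by
      rw [velocity_eq]
      ext k
      fin_cases k <;> simp [toMat_solElt, solMatrix, h11.fderiv, (hx ζ hζ).1, (hy ζ hζ).1,
        (hz ζ hζ).1, ← mul_assoc, ← Real.exp_add, ← Real.exp_neg]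
    have hvI : velocity (fun ζ => solElt (x ζ) (y ζ) (z ζ)) Complex.I ζ = fun k => b k ζ := by
      rw [velocity_eq]
      ext k
      fin_cases k <;> simp [toMat_solElt, solMatrix, h11.fderiv, (hx ζ hζ).2, (hy ζ hζ).2,
        (hz ζ hζ).2, ← mul_assoc, ← Real.exp_add, ← Real.exp_neg]
    have hd : DifferentiableAt ℝ (fun w => Sol.toMat (solElt (x w) (y w) (z w)) 1 1) ζ := by
      simpa [toMat_solElt, solMatrix] using h11.differentiableAt
    have hZ : ∀ k, spinorVec (ψ₁ ζ) (ψ₂ ζ) k =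
        1 / 2 * ((a k ζ : ℂ) - Complex.I * (b k ζ : ℂ)) := by
      intro k
      apply Complex.ext <;> simp [ha, hb]
    rw [solBasis_sum_apply, leftDz, leftDeriv_eq_velocity hd, leftDeriv_eq_velocity hd, hv1, hvI,
      hZ, hZ, hZ]
    ext i j
    fin_cases i <;> fin_cases j <;> simp
    ring

/-! # Surfaces in a conformal chart -/

/-- What has to be shown is that the spinor has no zeros: at a zero Z = 0, so the derivative of f in
the chart kills the direction 1, contrary to immersion. -/
theorem IsSurface.spinorSurface {M : Type*} [TopologicalSpace M] [ChartedSpace ℂ M]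
    [IsManifold 𝓘(ℝ, ℂ) ∞ M] {f : M → Sol} (hf : IsSurface f) {φ : OpenPartialHomeomorph M ℂ}
    (hφ : φ ∈ IsManifold.maximalAtlas 𝓘(ℝ, ℂ) ∞ M) {ψ₁ ψ₂ : ℂ → ℂ}
    (hψ : IsGeneratingSpinor φ.target (fun ζ => f (φ.symm ζ)) ψ₁ ψ₂) :
    SpinorSurface φ.target (fun ζ => f (φ.symm ζ)) ψ₁ ψ₂ := by
  set G : M → Fin 3 → Fin 3 → ℝ := fun p i j => Sol.toMat (f p) i j
  have hsymm : ContMDiffOn 𝓘(ℝ, ℂ) 𝓘(ℝ, ℂ) ∞ φ.symm φ.target :=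
    contMDiffOn_symm_of_mem_maximalAtlas hφ
  have hmd : φ.MDifferentiable 𝓘(ℝ, ℂ) 𝓘(ℝ, ℂ) :=
    ⟨(contMDiffOn_of_mem_maximalAtlas hφ).mdifferentiableOn (by simp),
      hsymm.mdifferentiableOn (by simp)⟩
  have hs : ContDiffOn ℝ ∞ (fun ζ (i j : Fin 3) => Sol.toMat (f (φ.symm ζ)) i j) φ.target := by
    rw [← contMDiffOn_iff_contDiffOn]
    exact hf.smooth.comp_contMDiffOn hsymm
  have hsij := contDiffOn_toMat_iff (F := fun ζ => f (φ.symm ζ)) |>.1 hs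
  refine ⟨φ.open_target, hsij, hψ, fun ζ hζ => ?_⟩
  by_contra hn
  push Not at hn
  have hd : ∀ i j, DifferentiableAt ℝ (fun w => Sol.toMat (f (φ.symm w)) i j) ζ :=
    fun i j => (hsij i j).differentiableAt_of_isOpen φ.open_target hζ
  have hv : ∀ k, velocity (fun ζ => f (φ.symm ζ)) 1 ζ k = 0 := by
    intro k
    rw [(hψ.velocity hζ k).1, hn.1, hn.2, spinorVec_re]
    fin_cases k <;> simp
  have hl : leftDeriv (fun ζ => f (φ.symm ζ)) 1 ζ = 0 := by
    rw [leftDeriv_eq_velocity (hd 1 1), hv, hv, hv]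
    ext i j
    fin_cases i <;> fin_cases j <;> simp
  -- Left translation is undone by multiplying with the invertible matrix of f.
  have hF0 : Matrix.of (fun i j => fderiv ℝ (fun w => Sol.toMat (f (φ.symm w)) i j) ζ 1) = 0 := by
    have hm : Sol.toMat (f (φ.symm ζ)) * Sol.toMat (f (φ.symm ζ))⁻¹ = 1 := by
      have := congrArg (fun g : Sol => Sol.toMat g) (mul_inv_cancel (f (φ.symm ζ)))
      exact this
    have := congrArg (fun X => Sol.toMat (f (φ.symm ζ)) * X) hl
    simp only [leftDeriv, mul_zero, ← mul_assoc, hm, one_mul] at this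
    exact this
  have hD0 : fderiv ℝ (fun ζ (i j : Fin 3) => Sol.toMat (f (φ.symm ζ)) i j) ζ 1 = 0 := by
    ext i j
    rw [fderiv_toMat_apply (F := fun ζ => f (φ.symm ζ)) hd]
    exact congrFun (congrFun hF0 i) j
  have hcomp : mfderiv 𝓘(ℝ, ℂ) 𝓘(ℝ, Fin 3 → Fin 3 → ℝ) (G ∘ φ.symm) ζ =
      (mfderiv 𝓘(ℝ, ℂ) 𝓘(ℝ, Fin 3 → Fin 3 → ℝ) G (φ.symm ζ)).comp
        (mfderiv 𝓘(ℝ, ℂ) 𝓘(ℝ, ℂ) φ.symm ζ) :=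
    mfderiv_comp ζ (hf.smooth.mdifferentiableAt (by simp)) (hmd.mdifferentiableAt_symm hζ)
  have hinj : Function.Injective
      (mfderiv 𝓘(ℝ, ℂ) 𝓘(ℝ, Fin 3 → Fin 3 → ℝ) (G ∘ φ.symm) ζ) := by
    rw [hcomp]
    exact (hf.immersion _).comp (hmd.symm.mfderiv_injective hζ)
  rw [mfderiv_eq_fderiv] at hinj
  have h1 : (1 : ℂ) = 0 := hinj (hD0.trans
    (ContinuousLinearMap.map_zero (fderiv ℝ (G ∘ φ.symm) ζ)).symm)
  exact one_ne_zero h1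

theorem ofReal_norm_sq (a : ℂ) : ((‖a‖ : ℝ) : ℂ) ^ 2 = a * conj a := by
  rw [Complex.mul_conj, ← Complex.ofReal_pow, Complex.sq_norm]

end

/-! ### The theorem, assembled. -/

theorem mainTheorem3 :
    (∀ (M : Type*) [TopologicalSpace M] [ChartedSpace ℂ M] [IsManifold 𝓘(ℝ, ℂ) ∞ M]
      (f : M → Sol) (_ : IsSurface f)
      (φ : OpenPartialHomeomorph M ℂ) (_ : φ ∈ IsManifold.maximalAtlas 𝓘(ℝ, ℂ) ∞ M)
      (F : ℂ → Sol) (_ : F = fun ζ => f (φ.symm ζ)) (_ : IsConformalOn φ.target F)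
      (ψ₁ ψ₂ : ℂ → ℂ) (_ : IsGeneratingSpinor φ.target F ψ₁ ψ₂)
      (α : ℂ → ℝ) (_ : α = logFactor F) (H : ℂ → ℝ) (_ : H = meanCurvature F)
      (A : ℂ → ℂ) (_ : A = hopfCoeff F),
      -- the Dirac equations
      SolDirac φ.target H ψ₁ ψ₂ ∧
      -- the Hopf differential
      (∀ ζ ∈ φ.target,
        A ζ = (conj (ψ₂ ζ) * dz ψ₁ ζ - ψ₁ ζ * dz (fun w => conj (ψ₂ w)) ζ)
          + 1 / 2 * (conj (ψ₂ ζ) ^ 4 - ψ₁ ζ ^ 4)) ∧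
      -- the remaining Weingarten equations
      (∀ ζ ∈ flatSet φ.target ψ₁ ψ₂ ∪ regularSet φ.target ψ₁ ψ₂,
        dz ψ₁ ζ = dz (fun w => (α w : ℂ)) ζ * ψ₁ ζ
          + A ζ * Real.exp (-α ζ) * ψ₂ ζ - 1 / 2 * conj (ψ₂ ζ) ^ 3 ∧
        dzbar ψ₂ ζ = -conj (A ζ) * Real.exp (-α ζ) * ψ₁ ζ
          + dzbar (fun w => (α w : ℂ)) ζ * ψ₂ ζ - 1 / 2 * conj (ψ₁ ζ) ^ 3) ∧
      -- the Codazzi equations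
      (∀ ζ ∈ φ.target,
        dzbar (dz (fun w => (α w : ℂ))) ζ - (Real.exp (-2 * α ζ) * ‖A ζ‖ ^ 2 : ℝ)
            + (1 / 4 * Real.exp (2 * α ζ) * H ζ ^ 2 : ℝ)
          = (1 / 4 * (6 * ‖ψ₁ ζ‖ ^ 2 * ‖ψ₂ ζ‖ ^ 2 - (‖ψ₁ ζ‖ ^ 4 + ‖ψ₂ ζ‖ ^ 4)) : ℝ) ∧
        dzbar A ζ - 1 / 2 * dz (fun w => (H w : ℂ)) ζ * Real.exp (2 * α ζ)
          = (‖ψ₂ ζ‖ ^ 4 - ‖ψ₁ ζ‖ ^ 4 : ℝ) * (ψ₁ ζ * conj (ψ₂ ζ)))) ∧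
    -- solutions of the Dirac equations generate surfaces
    (∀ (D : Set ℂ) (_ : IsOpen D) (_ : SimplyConnectedSpace D)
      (ψ₁ ψ₂ : ℂ → ℂ) (_ : ContDiffOn ℝ ∞ ψ₁ D) (_ : ContDiffOn ℝ ∞ ψ₂ D)
      (_ : ∀ ζ ∈ D, ψ₁ ζ ≠ 0 ∨ ψ₂ ζ ≠ 0)
      (H : ℂ → ℝ) (_ : SolDirac D H ψ₁ ψ₂) (P : ℂ) (_ : P ∈ D) (g : Sol),
      ∃ F : ℂ → Sol, F P = g ∧ IsConformalSurfaceOn D F ∧ IsGeneratingSpinor D F ψ₁ ψ₂ ∧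
        ∀ ζ ∈ regularSet D ψ₁ ψ₂, meanCurvature F ζ = H ζ) := by
  refine ⟨?_, ?_⟩
  · rintro M _ _ _ f hf φ hφ F rfl - ψ₁ ψ₂ hψ α rfl H rfl A rfl
    have h := hf.spinorSurface hφ hψ
    have hexp2 : ∀ ζ ∈ φ.target, Real.exp (2 * logFactor (fun ζ => f (φ.symm ζ)) ζ) =
        spinorSq (ψ₁ ζ) (ψ₂ ζ) ^ 2 := fun ζ hζ => by
      rw [← h.exp_logFactor hζ, ← Real.exp_nat_mul]; norm_num
    refine ⟨h.solDirac, fun ζ hζ => h.hopfCoeff_eq hζ, fun ζ hζ => ?_, fun ζ hζ => ?_⟩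
    · have hζ' : ζ ∈ φ.target := hζ.elim (fun h0 => (interior_subset h0).1) fun h0 => h0.1
      rw [Real.exp_neg, h.exp_logFactor hζ', Complex.ofReal_inv]
      exact h.weingarten hζ'
    · obtain ⟨c1, c2⟩ := h.codazzi hζ
      have hexp2' : Real.exp (-2 * logFactor (fun ζ => f (φ.symm ζ)) ζ) =
          (spinorSq (ψ₁ ζ) (ψ₂ ζ) ^ 2)⁻¹ := by
        rw [← hexp2 ζ hζ, ← Real.exp_neg]; congr 1; ring
      have n4 : ∀ a : ℂ, ((‖a‖ : ℝ) : ℂ) ^ 4 = (a * conj a) ^ 2 := fun a => by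
        rw [← ofReal_norm_sq]; ring
      rw [hexp2 ζ hζ, hexp2']
      push_cast
      simp only [n4, ofReal_norm_sq]
      constructor
      · rw [← c1]; ring
      · exact c2
  · intro D hD hsc ψ₁ ψ₂ h₁ h₂ hne H hS P _ g
    obtain ⟨F, hFP, h⟩ := exists_spinorSurface hD hsc h₁ h₂ hne hS P g
    refine ⟨F, hFP, h.isConformalSurfaceOn, h.generating, fun ζ hζ => ?_⟩
    have hn := mul_ne_zero_iff.1 hζ.2
    have hn2 : ψ₂ ζ ≠ 0 := fun h0 => hn.2 (by rw [h0, map_zero])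
    -- The spinor satisfies the equation for ∂̄ψ₁ both with the prescribed H and with the mean
    -- curvature of F. Cancelling ψ₂ and ρ, nonzero here, identifies the two.
    have e := ((diracAt_iff hn.1 hn2).1 (hS.1 ζ hζ)).1
    rw [(h.dirac hζ.1).1] at e
    have e' := mul_right_cancel₀ hn2 (add_right_cancel e)
    have e'' := mul_right_cancel₀ (spinorSq_pos (hne ζ hζ.1)).ne' (Complex.ofReal_injective e')
    linarith
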